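/- Let $(\Omega,\mathcal F,P)$ be the standard probability space, i.e. $\Omega=[0,1]$ with its Borel $\sigma$-algebra and the uniform distribution $P$. Let $1\le p<\infty$, $\frac1p+\frac1q=1$ (so $1<q\le\infty$) and $0\le\lambda\le1$. The $p$-semideviation is $$\rho(Z)=\mathbb E[Z]+\lambda\,\bigl\|(Z-\mathbb E Z)_+\bigr\|_p,\qquad Z\in L_p(\Omega,\mathcal F,P).$$ Notation. For a random variable $Z$ let $F_Z(t)=P(Z\le t)$ and $F_Z^{-1}(\tau)=\sup\{t:F_Z(t)\le\tau\}$, and for $\alpha\in[0,1)$ let ${\sf AV@R}_\alpha(Z)=\frac1{1-\alpha}\int_\alpha^1F_Z^{-1}(\tau)\,d\tau$. A spectral function is a nonnegative, nondecreasing, right-continuous function $\sigma$ on $[0,1)$ with $\int_0^1\sigma(u)\,du=1$; $\mathfrak S_q$ is the set of spectral functions with $\|\sigma\|_q<\infty$, and $\rho_\sigma(Z)=\int_0^1\sigma(u)F_Z^{-1}(u)\,du$. Let $\mathfrak P$ be the set of probability measures on $[0,1]$ with no mass at $1$, with the weak topology, put $(\mathbb T\mu)(\tau)=\int_{[0,\tau]}(1-\alpha)^{-1}\,d\mu(\alpha)$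 for $\mu\in\mathfrak P$ and $\tau\in[0,1)$, and let $\mathfrak P_q=\{\mu\in\mathfrak P:\mathbb T\mu\in L_q\}$. A set $\mathfrak M\subset\mathfrak P$ is a Kusuoka set of $\rho$ if $\rho(Z)=\sup_{\mu\in\mathfrak M}\int_0^1{\sf AV@R}_\alpha(Z)\,d\mu(\alpha)$ for all $Z\in L_p$, all these integrals being finite; it is the minimal Kusuoka set if moreover it is closed in $\mathfrak P$ and is contained in every Kusuoka set of $\rho$ that is closed in $\mathfrak P$. Proposition. (1) For every $Z\in L_p$, the integral defining $\rho_\sigma(Z)$ converges for every $\sigma\in\mathfrak S_q$, and $$\rho(Z)=\sup_{\sigma\in\mathfrak S_q}\Bigl\{\Bigl(1-\frac{\lambda}{\|\sigma\|_q}\Bigr)\mathbb E[Z]+\frac{\lambda}{\|\sigma\|_q}\,\rho_\sigma(Z)\Bigr\}.$$ (2) This is a Kusuoka representation: the set $$\mathfrak M=\Bigl\{\Bigl(1-\frac{\lambda}{\|\mathbb T\mu\|_q}\Bigr)\delta_0+\frac{\lambda}{\|\mathbb T\mu\|_q}\,\mu\;:\;\mu\in\mathfrak P_q\Bigr\}\subset\mathfrak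 P$$ is a Kusuoka set of $\rho$. (3) If $p>1$, then $\mathfrak M$ is the minimal Kusuoka set of $\rho$. -/

import Mathlib

open MeasureTheory Set
open scoped ENNReal

noncomputable section

namespace Kusuoka

/-- The right side quantile function `τ ↦ sup {t : F_Z(t) ≤ τ}` of a random variable `Z`, where
`F_Z(t) = P(Z ≤ t)`; it is meant for levels `0 < τ < 1`, where the supremum is finite. -/
def quantile {Ω : Type*} [MeasurableSpace Ω] (P : Measure Ω) (Z : Ω → ℝ) (τ : ℝ) : ℝ :=
  sSup {t : ℝ | P.real {ω | Z ω ≤ t} ≤ τ}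

/-- The (upper) Average Value-at-Risk at level `α ∈ [0, 1)`. -/
def avar {Ω : Type*} [MeasurableSpace Ω] (P : Measure Ω) (α : ℝ) (Z : Ω → ℝ) : ℝ :=
  (1 - α)⁻¹ * ∫ τ in Ico α 1, quantile P Z τ

/-- Lebesgue measure on `[0, 1)`, the domain of spectral functions. -/
def lebUnit : Measure ℝ := volume.restrict (Ico (0 : ℝ) 1)

/-- Spectral functions on `[0, 1)`: nonnegative, nondecreasing, right side continuous, with
integral one. Only the values of `σ` on `[0, 1)` matter. -/
structure IsSpectral (σ : ℝ → ℝ) : Prop where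
  nonneg : ∀ u ∈ Ico (0 : ℝ) 1, 0 ≤ σ u
  monotoneOn : MonotoneOn σ (Ico (0 : ℝ) 1)
  rightCont : ∀ u ∈ Ico (0 : ℝ) 1, ContinuousWithinAt σ (Ici u) u
  integrable : Integrable σ lebUnit
  integral_eq_one : ∫ u, σ u ∂lebUnit = 1

/-- The norm `‖σ‖_q` in `L_q[0, 1]`, for `σ` in that space. -/
def specNorm (q : ℝ≥0∞) (σ : ℝ → ℝ) : ℝ := (eLpNorm σ q lebUnit).toReal

/-- The spectral risk measure `ρ_σ(Z) = ∫₀¹ σ(u) F_Z⁻¹(u) du`. -/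
def spectralRisk {Ω : Type*} [MeasurableSpace Ω] (P : Measure Ω) (σ : ℝ → ℝ) (Z : Ω → ℝ) : ℝ :=
  ∫ u, σ u * quantile P Z u ∂lebUnit

/-- The probability measures on `[0, 1]` with zero mass at `1`, with the weak topology
(inherited from `ProbabilityMeasure`). -/
abbrev Prob : Type := {μ : ProbabilityMeasure unitInterval // (μ : Measure unitInterval) {1} = 0}

/-- The map `(𝕋 μ)(τ) = ∫_{[0, τ]} (1 - α)⁻¹ dμ(α)`, for `τ ∈ [0, 1)`. -/
def spectrumOf (μ : Prob) (τ : ℝ) : ℝ :=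
  ∫ α in {α : unitInterval | (α : ℝ) ≤ τ}, (1 - (α : ℝ))⁻¹ ∂(μ.1 : Measure unitInterval)

/-- `M` is a Kusuoka set of the functional `ρ` on `L_p(Ω, P)`:
`ρ(Z) = sup_{μ ∈ M} ∫ AV@R_α(Z) dμ(α)` for all `Z`, all the integrals being finite. -/
def IsKusuokaSet {Ω : Type*} [MeasurableSpace Ω] (P : Measure Ω) (p : ℝ≥0∞)
    (ρ : (Ω → ℝ) → ℝ) (M : Set Prob) : Prop :=
  ∀ Z : Ω → ℝ, MemLp Z p P →
    (∀ μ ∈ M, Integrable (fun α : unitInterval => avar P α Z) (μ.1 : Measure unitInterval)) ∧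
    IsLUB ((fun μ : Prob => ∫ α, avar P (α : unitInterval) Z ∂(μ.1 : Measure unitInterval)) '' M) (ρ Z)

/-- The minimal Kusuoka set: a closed Kusuoka set contained in every closed Kusuoka set. -/
structure IsMinimalKusuokaSet {Ω : Type*} [MeasurableSpace Ω] (P : Measure Ω) (p : ℝ≥0∞)
    (ρ : (Ω → ℝ) → ℝ) (M : Set Prob) : Prop where
  isKusuokaSet : IsKusuokaSet P p ρ M
  isClosed : IsClosed M
  subset : ∀ M' : Set Prob, IsClosed M' → IsKusuokaSet P p ρ M' → M ⊆ M'

/-- The `p`-semideviation `E Z + lam ‖(Z - E Z)₊‖_p`. -/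
def semideviation {Ω : Type*} [MeasurableSpace Ω] (P : Measure Ω) (p : ℝ≥0∞) (lam : ℝ)
    (Z : Ω → ℝ) : ℝ :=
  (∫ ω, Z ω ∂P) + lam * (eLpNorm (fun ω => max (Z ω - ∫ ω', Z ω' ∂P) 0) p P).toReal

/-- The set of all measures `(1 - lam / ‖𝕋 μ‖_q) δ₀ + (lam / ‖𝕋 μ‖_q) μ`, where `μ` ranges over the
measures with `𝕋 μ ∈ L_q`. -/
def semideviationSet (q : ℝ≥0∞) (lam : ℝ) : Set Prob :=
  {ν | ∃ μ : Prob, MemLp (spectrumOf μ) q lebUnit ∧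
    (ν.1 : Measure unitInterval) =
      ENNReal.ofReal (1 - lam / specNorm q (spectrumOf μ)) • Measure.dirac (0 : unitInterval) +
      ENNReal.ofReal (lam / specNorm q (spectrumOf μ)) • (μ.1 : Measure unitInterval)}

end Kusuoka

end

open Filter Topology ProbabilityTheory

namespace Kusuoka

/-! Everything is moved to `[0, 1)`: `Z` has the law of its quantile function `G` under Lebesgue
measure, so `ρ(Z)` is the semideviation of `G`. Put `m = E Z`.

Spectral formula. For a spectral `σ`, `∫ σ (G - m) ≤ ∫ σ (G - m)₊ ≤ ‖σ‖_q ‖(G - m)₊‖_p`; multiplying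
by `λ / ‖σ‖_q` gives the upper bound (`mixture_le_semideviation`). Equality holds when `σ` is the
normalised Hölder dual of `(G - m)₊`: its power `p - 1` if `p > 1`, the indicator of its support if
`p = 1`. Because `G` is nondecreasing and right continuous, this dual is itself a spectral function
(`exists_dual_spectral`).

Kusuoka form. By Fubini, `∫ AV@R_α(Z) dμ(α) = ∫ 𝕋μ · G` (`integral_tailAverage`), and `𝕋` is an
affine bijection onto the spectral functions sending `δ₀` to `1` (`exists_spectrumOf_eq`,
`eq_of_spectrumOf_ae_eq`). So the two suprema run over the same numbers.

Minimality, `p > 1`, hence `1 < q < ∞`. The set `𝔐` consists of the `ν` with `𝕋ν ∈ L_q` and `‖𝕋ν -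
𝕋ν(0)‖_q ≤ λ`. Duality with bounded monotone test functions `g`, constant near `1`, shows that this
condition is equivalent to `∫ 𝕋ν · g ≤ ρ(g)` for all such `g`. Each left side is weakly continuous
in `ν`, so `𝔐` is closed.

Let `M` be any closed Kusuoka set. Tests `1_{[a,1)}` with `a → 1` prevent mass from escaping to `1`,
so `M` is compact and attains `ρ(g)` at every test (`exists_eq_semideviation`). For `λ > 0` and `ν ∈
𝔐`, write `𝕋ν = k + f` with `f ≥ 0`, `‖f‖_q = λ`, and approximate `f` by tests `fₙ` vanishing near
`0`. Lower `fₙ^(q-1)` near `0` to mean zero. By equality in Hölder, a measure `κₙ ∈ M` attaining `ρ`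
at this test has `𝕋κₙ = 𝕋κₙ(0) + (λ / ‖fₙ‖_q) fₙ`. Total mass one forces `𝕋κₙ(0) → k`, so `κₙ`
converges to `ν` against all tests, and `ν ∈ M`. -/

lemma lebUnit_eq_restrict_Ioo : lebUnit = volume.restrict (Ioo (0 : ℝ) 1) :=
  Measure.restrict_congr_set Ioo_ae_eq_Ico.symm

instance : IsProbabilityMeasure lebUnit := ⟨by simp [lebUnit]⟩

lemma ae_lebUnit_mem_Ioo : ∀ᵐ u ∂lebUnit, u ∈ Ioo (0 : ℝ) 1 := by
  rw [lebUnit_eq_restrict_Ioo]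
  exact ae_restrict_mem measurableSet_Ioo

lemma ae_lebUnit_of_forall {p : ℝ → Prop} (h : ∀ u ∈ Ioo (0 : ℝ) 1, p u) : ∀ᵐ u ∂lebUnit, p u :=
  ae_lebUnit_mem_Ioo.mono h

/-! ### Quantile functions and reduction to `[0, 1)` -/

section Quantile

variable {Ω : Type*} [MeasurableSpace Ω] {P : Measure Ω} [IsProbabilityMeasure P] {Z : Ω → ℝ}

lemma quantile_eq_sSup_cdf (hZ : AEMeasurable Z P) (u : ℝ) :
    quantile P Z u = sSup {t | cdf (P.map Z) t ≤ u} := by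
  have := Measure.isProbabilityMeasure_map hZ
  simp only [quantile, cdf_eq_real, measureReal_def,
    Measure.map_apply_of_aemeasurable hZ measurableSet_Iic]
  rfl

lemma cdf_level_nonempty (ν : Measure ℝ) {u : ℝ} (hu : 0 < u) :
    {t | cdf ν t ≤ u}.Nonempty :=
  ((tendsto_cdf_atBot ν).eventually (eventually_le_nhds hu)).exists

lemma cdf_level_bddAbove (ν : Measure ℝ) {u : ℝ} (hu : u < 1) :
    BddAbove {t | cdf ν t ≤ u} := by
  obtain ⟨t, ht⟩ := ((tendsto_cdf_atTop ν).eventually (eventually_gt_nhds hu)).exists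
  refine ⟨t, fun t' ht' => ?_⟩
  by_contra! h
  exact absurd (ht.trans_le (monotone_cdf ν h.le)) (not_lt.2 ht')

lemma quantile_le_of_lt_cdf (hZ : AEMeasurable Z P) {u t : ℝ} (hu : 0 < u)
    (h : u < cdf (P.map Z) t) : quantile P Z u ≤ t := by
  rw [quantile_eq_sSup_cdf hZ]
  refine csSup_le (cdf_level_nonempty _ hu) fun t' ht' => ?_
  by_contra! hlt
  exact absurd (h.trans_le (monotone_cdf _ hlt.le)) (not_lt.2 ht')

lemma le_quantile_of_cdf_le (hZ : AEMeasurable Z P) {u t : ℝ} (hu : u < 1)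
    (h : cdf (P.map Z) t ≤ u) : t ≤ quantile P Z u := by
  rw [quantile_eq_sSup_cdf hZ]
  exact le_csSup (cdf_level_bddAbove _ hu) h

lemma le_cdf_of_quantile_le (hZ : AEMeasurable Z P) {u t : ℝ} (hu : u < 1)
    (h : quantile P Z u ≤ t) : u ≤ cdf (P.map Z) t := by
  have hc := ((cdf (P.map Z)).right_continuous t).tendsto.mono_left
    (nhdsWithin_mono t Ioi_subset_Ici_self)
  refine ge_of_tendsto hc (eventually_nhdsWithin_of_forall fun t' ht' => ?_)
  by_contra! hlt
  exact absurd (le_quantile_of_cdf_le hZ hu hlt.le) (not_le.2 (h.trans_lt ht'))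

lemma quantile_monotoneOn (hZ : AEMeasurable Z P) : MonotoneOn (quantile P Z) (Ioo 0 1) := by
  intro u hu v hv huv
  rw [quantile_eq_sSup_cdf hZ, quantile_eq_sSup_cdf hZ]
  exact csSup_le_csSup (cdf_level_bddAbove _ hv.2) (cdf_level_nonempty _ hu.1)
    fun t ht => le_trans ht huv

lemma aemeasurable_quantile (hZ : AEMeasurable Z P) : AEMeasurable (quantile P Z) lebUnit := by
  rw [lebUnit_eq_restrict_Ioo]
  exact aemeasurable_restrict_of_monotoneOn measurableSet_Ioo (quantile_monotoneOn hZ)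

/-- Up to null sets, `{u : G u ≤ t}` lies between `(0, F(t))` and `(0, F(t)]`, so it has measure
`F(t)`; distribution functions determine laws on the line. -/
lemma identDistrib_quantile (hZ : AEMeasurable Z P) :
    IdentDistrib (quantile P Z) Z lebUnit P := by
  have hG := aemeasurable_quantile hZ
  have := Measure.isProbabilityMeasure_map hZ
  refine ⟨hG, hZ, ?_⟩
  have := Measure.isProbabilityMeasure_map hG
  refine Measure.ext_of_Iic _ _ fun t => ?_
  rw [Measure.map_apply_of_aemeasurable hG measurableSet_Iic, ← ofReal_cdf (P.map Z),
    lebUnit_eq_restrict_Ioo, Measure.restrict_apply' measurableSet_Ioo]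
  refine le_antisymm ?_ ?_
  · have : ENNReal.ofReal (cdf (P.map Z) t) = volume (Ioc 0 (cdf (P.map Z) t)) := by simp
    rw [this]
    exact measure_mono fun u hu => ⟨hu.2.1, le_cdf_of_quantile_le hZ hu.2.2 hu.1⟩
  · have : ENNReal.ofReal (cdf (P.map Z) t) = volume (Ioo 0 (cdf (P.map Z) t)) := by simp
    rw [this]
    exact measure_mono fun u hu =>
      ⟨quantile_le_of_lt_cdf hZ hu.1 hu.2, hu.1, hu.2.trans_le (cdf_le_one _ _)⟩

lemma memLp_quantile {p : ℝ≥0∞} (hZ : MemLp Z p P) : MemLp (quantile P Z) p lebUnit :=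
  (identDistrib_quantile hZ.1.aemeasurable).symm.memLp_snd hZ

lemma integral_quantile (hZ : AEMeasurable Z P) :
    ∫ u, quantile P Z u ∂lebUnit = ∫ ω, Z ω ∂P :=
  (identDistrib_quantile hZ).integral_eq

lemma semideviation_eq_quantile (p : ℝ≥0∞) (lam : ℝ) (hZ : AEMeasurable Z P) :
    semideviation P p lam Z = semideviation lebUnit p lam (quantile P Z) := by
  have h : IdentDistrib (fun u => max (quantile P Z u - ∫ ω, Z ω ∂P) 0)
      (fun ω => max (Z ω - ∫ ω, Z ω ∂P) 0) lebUnit P :=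
    (identDistrib_quantile hZ).comp (u := fun x => max (x - ∫ ω, Z ω ∂P) 0) (by fun_prop)
  rw [semideviation, semideviation, integral_quantile hZ, h.eLpNorm_eq]

/-- The maximum of the quantile function and a constant is monotone and right continuous on all
of `[0, 1)`, once its value at `0` is corrected. -/
lemma exists_monotoneOn_rightCont_max_quantile (hZ : AEMeasurable Z P) (m : ℝ) :
    ∃ Q : ℝ → ℝ, (∀ u ∈ Ioo (0 : ℝ) 1, Q u = max (quantile P Z u) m) ∧
      MonotoneOn Q (Ico 0 1) ∧ (∀ u ∈ Ico (0 : ℝ) 1, ContinuousWithinAt Q (Ici u) u) ∧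
      ∀ u ∈ Ico (0 : ℝ) 1, m ≤ Q u := by
  set F := cdf (P.map Z)
  -- Adding `Iic m` to the level set turns its supremum into the maximum with `m`. It also keeps the
  -- set nonempty at `u = 0`, where the level set of the distribution function may be empty and its
  -- `sSup` meaningless.
  set S : ℝ → Set ℝ := fun u => {t | F t ≤ u} ∪ Iic m
  have hne : ∀ u, (S u).Nonempty := fun u => ⟨m, Or.inr (mem_Iic.2 le_rfl)⟩
  have hbdd : ∀ u < 1, BddAbove (S u) := fun u hu =>
    (cdf_level_bddAbove _ hu).union bddAbove_Iic
  have hmono : MonotoneOn (fun u => sSup (S u)) (Ico 0 1) := fun u hu v hv huv =>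
    csSup_le_csSup (hbdd v hv.2) (hne u) (union_subset_union_left _ fun t ht => le_trans ht huv)
  refine ⟨fun u => sSup (S u), fun u hu => ?_, hmono, fun u hu => ?_,
    fun u hu => le_csSup (hbdd u hu.2) (Or.inr (mem_Iic.2 le_rfl))⟩
  · have := csSup_union (cdf_level_bddAbove (P.map Z) hu.2)
      (cdf_level_nonempty (P.map Z) hu.1) (bddAbove_Iic (a := m)) nonempty_Iic
    rwa [csSup_Iic, ← quantile_eq_sSup_cdf hZ] at this
  · rw [ContinuousWithinAt, Metric.tendsto_nhds]
    intro ε hε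
    have hlt : u < F (sSup (S u) + ε / 2) := by
      by_contra! h
      linarith [le_csSup (hbdd u hu.2) (Or.inl h : sSup (S u) + ε / 2 ∈ S u)]
    have hm : m ≤ sSup (S u) := le_csSup (hbdd u hu.2) (Or.inr (mem_Iic.2 le_rfl))
    have h1 : ∀ᶠ v in 𝓝[≥] u, v < F (sSup (S u) + ε / 2) :=
      (eventually_lt_nhds hlt).filter_mono nhdsWithin_le_nhds
    have h2 : ∀ᶠ v in 𝓝[≥] u, v < 1 := (eventually_lt_nhds hu.2).filter_mono nhdsWithin_le_nhds
    filter_upwards [h1, h2, self_mem_nhdsWithin] with v hv hv1 huv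
    have hle := hmono hu ⟨hu.1.trans huv, hv1⟩ huv
    have hge : sSup (S v) ≤ sSup (S u) + ε / 2 := by
      refine csSup_le (hne v) fun t ht => ?_
      rcases ht with ht | ht
      · by_contra! hh
        exact absurd (hv.trans_le (monotone_cdf _ hh.le)) (not_lt.2 ht)
      · exact ht.trans (by linarith)
    simp only at hle
    rw [Real.dist_eq, abs_of_nonneg (by linarith)]
    linarith

end Quantile

/-! ### Monotone functions as random variables on `unitInterval` -/

lemma measurePreserving_coe_unitInterval :
    MeasurePreserving ((↑) : unitInterval → ℝ) volume (volume.restrict (Icc (0 : ℝ) 1)) :=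
  measurePreserving_subtype_coe measurableSet_Icc

lemma lebUnit_eq_restrict_Icc : lebUnit = volume.restrict (Icc (0 : ℝ) 1) :=
  Measure.restrict_congr_set Ico_ae_eq_Icc

lemma measurePreserving_coe_lebUnit :
    MeasurePreserving ((↑) : unitInterval → ℝ) volume lebUnit :=
  lebUnit_eq_restrict_Icc ▸ measurePreserving_coe_unitInterval

/-- A monotone right continuous function is its own quantile function. -/
lemma quantile_comp_coe {h : ℝ → ℝ} (hmono : Monotone h)
    (hc : ∀ u, ContinuousWithinAt h (Ici u) u) {u : ℝ} (hu : u ∈ Ioo (0 : ℝ) 1) :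
    quantile (volume : Measure unitInterval) (fun ω => h ω) u = h u := by
  have hm : Measurable h := hmono.measurable
  have hZ : AEMeasurable (fun ω : unitInterval => h ω) volume := by fun_prop
  have hF : ∀ t, cdf ((volume : Measure unitInterval).map fun ω : unitInterval => h ω) t =
      volume.real ({v | h v ≤ t} ∩ Icc 0 1) := by
    intro t
    have := Measure.isProbabilityMeasure_map hZ
    rw [cdf_eq_real, measureReal_def, measureReal_def,
      Measure.map_apply_of_aemeasurable hZ measurableSet_Iic,
      ← Measure.restrict_apply' measurableSet_Icc,
      ← measurePreserving_coe_unitInterval.measure_preimage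
        (measurableSet_le hm measurable_const).nullMeasurableSet]
    rfl
  refine le_antisymm ?_ ?_
  · have hc' := ((hc u).tendsto.mono_left (nhdsWithin_mono u Ioi_subset_Ici_self))
    refine ge_of_tendsto hc' ?_
    filter_upwards [self_mem_nhdsWithin,
      (eventually_lt_nhds hu.2).filter_mono nhdsWithin_le_nhds] with v hv hv1
    refine quantile_le_of_lt_cdf hZ hu.1 ?_
    rw [hF]
    have hsub : Icc 0 v ⊆ {w | h w ≤ h v} ∩ Icc 0 1 := fun w hw =>
      ⟨hmono hw.2, hw.1, hw.2.trans hv1.le⟩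
    have := measureReal_mono (μ := volume) hsub
      (measure_ne_top_of_subset inter_subset_right (by simp))
    simp only [Real.volume_real_Icc, sub_zero] at this
    exact lt_of_lt_of_le hv ((le_max_left _ _).trans this)
  · refine le_of_forall_lt fun t ht => ?_
    obtain ⟨t', h1, h2⟩ := exists_between ht
    refine h1.trans_le (le_quantile_of_cdf_le hZ hu.2 ?_)
    rw [hF]
    have hsub : {w | h w ≤ t'} ∩ Icc 0 1 ⊆ Icc 0 u := fun w hw =>
      ⟨hw.2.1, by by_contra! hlt; exact absurd (hmono hlt.le) (not_le.2 (hw.1.trans_lt h2))⟩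
    have := measureReal_mono (μ := volume) hsub (by simp)
    simpa [hu.1.le] using this

lemma quantile_comp_coe_ae {h : ℝ → ℝ} (hmono : Monotone h)
    (hc : ∀ u, ContinuousWithinAt h (Ici u) u) :
    quantile (volume : Measure unitInterval) (fun ω => h ω) =ᵐ[lebUnit] h :=
  ae_lebUnit_of_forall fun _ hu => quantile_comp_coe hmono hc hu

/-! ### The map `𝕋` and Fubini -/

/-- The kernel `(α, u) ↦ 1_{α ≤ u} (1 - α)⁻¹` of the map `𝕋`. -/
noncomputable def avarKernel (α : unitInterval) (u : ℝ) : ℝ :=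
  if (α : ℝ) ≤ u then (1 - (α : ℝ))⁻¹ else 0

/-- The average `(1 - α)⁻¹ ∫_α^1 g` of a function over `[α, 1)`. -/
noncomputable def tailAverage (g : ℝ → ℝ) (α : ℝ) : ℝ := (1 - α)⁻¹ * ∫ τ in Ico α 1, g τ

lemma measurable_avarKernel : Measurable fun x : unitInterval × ℝ => avarKernel x.1 x.2 := by
  unfold avarKernel
  exact Measurable.ite (measurableSet_le (by fun_prop) (by fun_prop)) (by fun_prop) (by fun_prop)

lemma avarKernel_nonneg (α : unitInterval) (u : ℝ) : 0 ≤ avarKernel α u := by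
  unfold avarKernel
  split_ifs
  · exact inv_nonneg.2 (sub_nonneg.2 α.2.2)
  · exact le_rfl

lemma avarKernel_le {α : unitInterval} {u v : ℝ} (huv : u ≤ v) (hv : v < 1) :
    avarKernel α u ≤ (1 - v)⁻¹ := by
  unfold avarKernel
  split_ifs with h
  · exact inv_anti₀ (by linarith) (by linarith)
  · exact inv_nonneg.2 (by linarith)

lemma spectrumOf_eq_integral_avarKernel (μ : Prob) (u : ℝ) :
    spectrumOf μ u = ∫ α, avarKernel α u ∂(μ.1 : Measure unitInterval) := by
  have hs : MeasurableSet {α : unitInterval | (α : ℝ) ≤ u} :=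
    measurableSet_le (by fun_prop) (by fun_prop)
  rw [spectrumOf, ← integral_indicator hs]
  rfl

lemma measurable_avarKernel_left (u : ℝ) : Measurable fun α => avarKernel α u :=
  measurable_avarKernel.comp (by fun_prop : Measurable fun α : unitInterval => (α, u))

lemma measurable_avarKernel_right (α : unitInterval) : Measurable fun u => avarKernel α u :=
  measurable_avarKernel.comp (by fun_prop : Measurable fun u : ℝ => (α, u))

lemma integrable_avarKernel_left (μ : Measure unitInterval) [IsFiniteMeasure μ] {u : ℝ}
    (hu : u < 1) : Integrable (fun α => avarKernel α u) μ :=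
  Integrable.of_bound (measurable_avarKernel_left u).aestronglyMeasurable (1 - u)⁻¹ (by
    filter_upwards with α
    rw [Real.norm_of_nonneg (avarKernel_nonneg α u)]
    exact avarKernel_le le_rfl hu)

lemma avarKernel_mono_right {α : unitInterval} : Monotone (avarKernel α) := by
  intro u v huv
  have := inv_nonneg.2 (sub_nonneg.2 α.2.2)
  unfold avarKernel
  split_ifs with h1 h2 <;> linarith

lemma ae_lt_one (μ : Prob) : ∀ᵐ α : unitInterval ∂(μ.1 : Measure unitInterval), (α : ℝ) < 1 := by
  have : ∀ᵐ α : unitInterval ∂(μ.1 : Measure unitInterval), α ∉ ({1} : Set unitInterval) :=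
    measure_eq_zero_iff_ae_notMem.1 μ.2
  filter_upwards [this] with α hα
  exact lt_of_le_of_ne α.2.2 fun h => hα (Subtype.ext h)

lemma spectrumOf_nonneg (μ : Prob) (u : ℝ) : 0 ≤ spectrumOf μ u := by
  rw [spectrumOf_eq_integral_avarKernel]
  exact integral_nonneg fun α => avarKernel_nonneg α u

lemma spectrumOf_monotoneOn (μ : Prob) : MonotoneOn (spectrumOf μ) (Iio 1) := by
  intro u hu v hv huv
  simp only [spectrumOf_eq_integral_avarKernel]
  exact integral_mono (integrable_avarKernel_left _ hu) (integrable_avarKernel_left _ hv)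
    fun α => avarKernel_mono_right huv

lemma spectrumOf_continuousWithinAt (μ : Prob) {u : ℝ} (hu : u < 1) :
    ContinuousWithinAt (spectrumOf μ) (Ici u) u := by
  -- Staying below some `v < 1` bounds the kernel by the constant `(1 - v)⁻¹`, as dominated
  -- convergence requires.
  obtain ⟨v, huv, hv⟩ := exists_between hu
  rw [funext (spectrumOf_eq_integral_avarKernel μ)]
  refine continuousWithinAt_of_dominated (bound := fun _ => (1 - v)⁻¹)
    (Eventually.of_forall fun w => (measurable_avarKernel_left w).aestronglyMeasurable) ?_
    (integrable_const _) (Eventually.of_forall fun α => ?_)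
  · filter_upwards [(eventually_le_nhds huv).filter_mono nhdsWithin_le_nhds] with w hw
    filter_upwards with α
    rw [Real.norm_of_nonneg (avarKernel_nonneg α w)]
    exact avarKernel_le hw hv
  · by_cases h : (α : ℝ) ≤ u
    · refine (continuousWithinAt_const (b := (1 - (α : ℝ))⁻¹)).congr (fun w hw => ?_) ?_
      · exact if_pos (h.trans hw)
      · exact if_pos h
    · refine (continuousWithinAt_const (b := (0 : ℝ))).congr_of_eventuallyEq ?_ (if_neg h)
      filter_upwards [(eventually_lt_nhds (not_le.1 h)).filter_mono nhdsWithin_le_nhds] with w hw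
      exact if_neg (not_le.2 hw)

lemma aemeasurable_spectrumOf (μ : Prob) : AEMeasurable (spectrumOf μ) lebUnit := by
  rw [lebUnit_eq_restrict_Ioo]
  exact aemeasurable_restrict_of_monotoneOn measurableSet_Ioo
    ((spectrumOf_monotoneOn μ).mono fun u hu => hu.2)

lemma integral_avarKernel_mul (g : ℝ → ℝ) (α : unitInterval) :
    ∫ u, avarKernel α u * g u ∂lebUnit = tailAverage g α := by
  have : (fun u => avarKernel α u * g u) =
      (Ici (α : ℝ)).indicator fun u => (1 - (α : ℝ))⁻¹ * g u := by
    ext u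
    by_cases h : (α : ℝ) ≤ u <;> simp [avarKernel, indicator, h]
  have hset : Ici (α : ℝ) ∩ Ico 0 1 = Ico (α : ℝ) 1 := by
    ext u
    exact ⟨fun h => ⟨h.1, h.2.2⟩, fun h => ⟨h.1, α.2.1.trans h.1, h.2⟩⟩
  rw [this, integral_indicator measurableSet_Ici, lebUnit, Measure.restrict_restrict
    measurableSet_Ici, integral_const_mul, tailAverage, hset]

lemma tailAverage_const (c : ℝ) {α : ℝ} (hα : α < 1) : tailAverage (fun _ => c) α = c := by
  have : 1 - α ≠ 0 := by linarith
  simp only [tailAverage, integral_const, MeasurableSet.univ, measureReal_restrict_apply,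
    univ_inter, Real.volume_real_Ico, smul_eq_mul, max_eq_left (sub_nonneg.2 hα.le)]
  field_simp

lemma integrable_avarKernel_right {α : unitInterval} : Integrable (avarKernel α) lebUnit :=
  Integrable.of_bound (measurable_avarKernel_right α).aestronglyMeasurable (1 - (α : ℝ))⁻¹ (by
    filter_upwards with u
    rw [Real.norm_of_nonneg (avarKernel_nonneg α u), avarKernel]
    split_ifs
    exacts [le_rfl, inv_nonneg.2 (sub_nonneg.2 α.2.2)])

/-- For `α < 1` the kernel is the density of the uniform law on `[α, 1)`, so its integral over `u`
is `1`. -/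
lemma integrable_avarKernel_prod (μ : Prob) :
    Integrable (fun x : unitInterval × ℝ => avarKernel x.1 x.2)
      ((μ.1 : Measure unitInterval).prod lebUnit) := by
  refine (integrable_prod_iff measurable_avarKernel.aestronglyMeasurable).2
    ⟨Eventually.of_forall fun α => integrable_avarKernel_right, ?_⟩
  refine (integrable_const (1 : ℝ)).congr ?_
  filter_upwards [ae_lt_one μ] with α hα
  simp only [Real.norm_of_nonneg (avarKernel_nonneg _ _)]
  have := integral_avarKernel_mul (fun _ => 1) α
  simp only [mul_one] at this
  rw [this, tailAverage_const 1 hα]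

lemma integrable_spectrumOf (μ : Prob) : Integrable (spectrumOf μ) lebUnit := by
  rw [funext (spectrumOf_eq_integral_avarKernel μ)]
  exact (integrable_avarKernel_prod μ).integral_prod_right

/-- Fubini: the mixture of tail averages is the integral against `𝕋 μ`. -/
lemma integral_tailAverage (μ : Prob) {g : ℝ → ℝ} (hg : AEStronglyMeasurable g lebUnit)
    (hint : Integrable (fun u => spectrumOf μ u * g u) lebUnit) :
    Integrable (fun α : unitInterval => tailAverage g α) (μ.1 : Measure unitInterval) ∧
      ∫ α, tailAverage g (α : unitInterval) ∂(μ.1 : Measure unitInterval) =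
        ∫ u, spectrumOf μ u * g u ∂lebUnit := by
  have hF : Integrable (fun x : unitInterval × ℝ => avarKernel x.1 x.2 * g x.2)
      ((μ.1 : Measure unitInterval).prod lebUnit) := by
    have hm : AEStronglyMeasurable (fun x : unitInterval × ℝ => avarKernel x.1 x.2 * g x.2)
        ((μ.1 : Measure unitInterval).prod lebUnit) :=
      measurable_avarKernel.aestronglyMeasurable.mul hg.comp_snd
    refine (integrable_prod_iff' hm).2 ⟨?_, ?_⟩
    · exact ae_lebUnit_of_forall fun u hu =>
        (integrable_avarKernel_left (μ.1 : Measure unitInterval) hu.2).mul_const (g u)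
    · refine hint.norm.congr (Eventually.of_forall fun u => ?_)
      simp only [norm_mul, Real.norm_of_nonneg (spectrumOf_nonneg _ _)]
      simp only [Real.norm_of_nonneg (avarKernel_nonneg _ _), integral_mul_const,
        spectrumOf_eq_integral_avarKernel]
  simp only [← integral_avarKernel_mul]
  refine ⟨hF.integral_prod_left, ?_⟩
  rw [integral_integral_swap hF]
  simp only [integral_mul_const, spectrumOf_eq_integral_avarKernel]

lemma integral_spectrumOf (μ : Prob) : ∫ u, spectrumOf μ u ∂lebUnit = 1 := by
  have h := (integral_tailAverage μ (g := fun _ => 1) aestronglyMeasurable_const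
    (by simpa using integrable_spectrumOf μ)).2
  simp only [mul_one] at h
  have h1 : (fun α : unitInterval => tailAverage (fun _ => 1) α)
      =ᵐ[(μ.1 : Measure unitInterval)] fun _ => 1 :=
    (ae_lt_one μ).mono fun α hα => tailAverage_const 1 hα
  rw [← h, integral_congr_ae h1]
  simp

lemma isSpectral_spectrumOf (μ : Prob) : IsSpectral (spectrumOf μ) where
  nonneg u _ := spectrumOf_nonneg μ u
  monotoneOn := (spectrumOf_monotoneOn μ).mono fun _ hu => hu.2
  rightCont _ hu := spectrumOf_continuousWithinAt μ hu.2
  integrable := integrable_spectrumOf μ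
  integral_eq_one := integral_spectrumOf μ

/-! ### Bijectivity of `𝕋` -/

/-- If equality failed on a whole right neighbourhood of `u`, it would fail on a set of positive
measure; so the two functions agree at points decreasing to `u`, hence in the limit. -/
lemma eq_of_ae_eq_of_rightCont {f g : ℝ → ℝ} (h : f =ᵐ[lebUnit] g) {u : ℝ}
    (hu : u ∈ Ico (0 : ℝ) 1) (hf : ContinuousWithinAt f (Ici u) u)
    (hg : ContinuousWithinAt g (Ici u) u) : f u = g u := by
  refine tendsto_nhds_unique_of_frequently_eq
    (hf.tendsto.mono_left (nhdsWithin_mono u Ioi_subset_Ici_self))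
    (hg.tendsto.mono_left (nhdsWithin_mono u Ioi_subset_Ici_self)) fun hne => ?_
  obtain ⟨w, hw, hsub⟩ := (mem_nhdsGT_iff_exists_Ioo_subset).1 hne
  have h0 : volume (Ioo u (min w 1)) = 0 := by
    refine measure_mono_null (t := {x | ¬ f x = g x} ∩ Ico 0 1) (fun x hx => ⟨hsub ⟨hx.1,
      hx.2.trans_le (min_le_left _ _)⟩, hu.1.trans hx.1.le, hx.2.trans_le (min_le_right _ _)⟩) ?_
    rw [← Measure.restrict_apply' measurableSet_Ico]
    exact h
  rw [Real.volume_Ioo, ENNReal.ofReal_eq_zero] at h0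
  have := lt_min hw hu.2
  linarith

/-- An inversion formula for `𝕋`. For `α ≤ t` one has `1 = (1 - t)/(1 - α) + (t - α)/(1 - α)`: the
first term is the kernel at `t`, scaled, and the second is the tail average of `1_{(-∞, t)}`. Both
vanish for `α > t`. Integrate in `α`. -/
lemma measureReal_Iic_eq (μ : Prob) {t : ℝ} (ht : t ∈ Ico (0 : ℝ) 1) :
    (μ.1 : Measure unitInterval).real {α | (α : ℝ) ≤ t} =
      (1 - t) * spectrumOf μ t + ∫ u in Iio t, spectrumOf μ u ∂lebUnit := by
  set g : ℝ → ℝ := (Iio t).indicator fun _ => 1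
  have hmul : (fun u => spectrumOf μ u * g u) = (Iio t).indicator (spectrumOf μ) := by
    ext u
    by_cases h : u < t <;> simp [g, indicator, h]
  have h := integral_tailAverage μ (g := g)
    ((measurable_const.indicator measurableSet_Iio).aestronglyMeasurable)
    (by rw [hmul]; exact (integrable_spectrumOf μ).indicator measurableSet_Iio)
  have hset : MeasurableSet {α : unitInterval | (α : ℝ) ≤ t} :=
    measurableSet_le (by fun_prop) (by fun_prop)
  rw [← integral_indicator measurableSet_Iio, ← hmul, ← h.2, spectrumOf_eq_integral_avarKernel,
    ← integral_const_mul, ← integral_add ((integrable_avarKernel_left _ ht.2).const_mul _) h.1,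
    ← integral_indicator_one hset]
  refine integral_congr_ae ((ae_lt_one μ).mono fun α hα => ?_)
  have h1 : 1 - (α : ℝ) ≠ 0 := by linarith
  have hg : ∫ τ in Ico (α : ℝ) 1, g τ = max (t - α) 0 := by
    rw [integral_indicator measurableSet_Iio, Measure.restrict_restrict measurableSet_Iio]
    have : Iio t ∩ Ico (α : ℝ) 1 = Ico (α : ℝ) t := by
      ext u
      simp only [mem_inter_iff, mem_Iio, mem_Ico]
      exact ⟨fun h => ⟨h.2.1, h.1⟩, fun h => ⟨h.2, h.1, h.2.trans ht.2⟩⟩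
    simp [this, measureReal_def, ENNReal.toReal_ofReal']
  simp only [tailAverage, hg, avarKernel]
  by_cases h : (α : ℝ) ≤ t
  · rw [if_pos h, max_eq_left (sub_nonneg.2 h), indicator_of_mem (by exact h)]
    simp only [Pi.one_apply]
    field_simp
    ring
  · rw [if_neg h, max_eq_right (by linarith), indicator_of_notMem (by exact h)]
    simp

/-- The map `𝕋` is injective. -/
lemma eq_of_spectrumOf_ae_eq {μ ν : Prob} (h : spectrumOf μ =ᵐ[lebUnit] spectrumOf ν) :
    μ = ν := by
  have hfin : IsFiniteMeasure (μ.1 : Measure unitInterval) := inferInstance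
  refine Subtype.ext (Subtype.ext (@Measure.ext_of_Iic _ _ _ _ _ _ _ _ _ hfin fun t => ?_))
  by_cases ht : (t : ℝ) < 1
  · have ht' : (t : ℝ) ∈ Ico (0 : ℝ) 1 := ⟨t.2.1, ht⟩
    have := measureReal_Iic_eq μ ht'
    rw [eq_of_ae_eq_of_rightCont h ht' (spectrumOf_continuousWithinAt μ ht)
      (spectrumOf_continuousWithinAt ν ht), integral_congr_ae (ae_restrict_of_ae h),
      ← measureReal_Iic_eq ν ht'] at this
    exact (measureReal_eq_measureReal_iff (measure_ne_top (μ.1 : Measure unitInterval) _)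
      (measure_ne_top (ν.1 : Measure unitInterval) _)).1 this
  · have : (Iic t : Set unitInterval) = univ := by
      ext α
      simpa using α.2.2.trans (not_lt.1 ht)
    simp [this]

/-- The map `𝕋` is onto the spectral functions. -/
lemma exists_spectrumOf_eq {σ : ℝ → ℝ} (hσ : IsSpectral σ) :
    ∃ μ : Prob, ∀ u ∈ Ico (0 : ℝ) 1, spectrumOf μ u = σ u := by
  -- The generalised inverse of `σ`. Pushing Lebesgue measure on `(0, ∞)` forward by it gives the
  -- Stieltjes measure `m` with `m [0, t] = σ t`, including an atom `σ 0` at `0`. The required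
  -- measure is `(1 - α) dm(α)`.
  set T : ℝ → unitInterval := fun y => sInf {u : unitInterval | (u : ℝ) < 1 ∧ y ≤ σ u}
  have hTmono : Monotone T := fun y z hyz => sInf_le_sInf fun u hu => ⟨hu.1, hyz.trans hu.2⟩
  have hTm : Measurable T := hTmono.measurable
  have hT : ∀ (y : ℝ) (t : unitInterval), (t : ℝ) < 1 → (T y ≤ t ↔ y ≤ σ t) := by
    intro y t ht
    refine ⟨fun h => ?_, fun h => sInf_le ⟨ht, h⟩⟩
    have hc := (hσ.rightCont t ⟨t.2.1, ht⟩).tendsto.mono_left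
      (nhdsWithin_mono (t : ℝ) Ioi_subset_Ici_self)
    refine ge_of_tendsto hc ?_
    filter_upwards [self_mem_nhdsWithin,
      (eventually_lt_nhds ht).filter_mono nhdsWithin_le_nhds] with v hv hv1
    have hv0 : 0 ≤ v := t.2.1.trans (le_of_lt hv)
    obtain ⟨u, hu, huv⟩ := sInf_lt_iff.1 (h.trans_lt
      (show t < (⟨v, hv0, hv1.le⟩ : unitInterval) from hv))
    exact hu.2.trans (hσ.monotoneOn ⟨u.2.1, hu.1⟩ ⟨hv0, hv1⟩ (le_of_lt huv))
  set m : Measure unitInterval := (volume.restrict (Ioi 0)).map T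
  have hm : ∀ t : unitInterval, (t : ℝ) < 1 → m (Iic t) = ENNReal.ofReal (σ t) := by
    intro t ht
    rw [Measure.map_apply hTm measurableSet_Iic, Measure.restrict_apply (hTm measurableSet_Iic)]
    have : T ⁻¹' Iic t ∩ Ioi 0 = Ioc 0 (σ t) := by
      ext y
      simp [hT y t ht, and_comm]
    simp [this]
  set d : unitInterval → ℝ≥0∞ := fun α => ENNReal.ofReal (1 - (α : ℝ))
  have hd : Measurable d := by fun_prop
  have hI : ∀ u : ℝ, MeasurableSet {α : unitInterval | (α : ℝ) ≤ u} := fun u =>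
    measurableSet_le (by fun_prop) (by fun_prop)
  have hmI : ∀ u ∈ Ico (0 : ℝ) 1, m {α | (α : ℝ) ≤ u} = ENNReal.ofReal (σ u) := fun u hu =>
    hm ⟨u, hu.1, hu.2.le⟩ hu.2
  -- Tonelli: `1 - α` is the length of `{u : α ≤ u < 1}`, so the mass is `∫ m [0, u] du = ∫ σ = 1`.
  have hmass : m.withDensity d univ = 1 := by
    have h1 : ∀ α : unitInterval,
        d α = ∫⁻ u, {u | (α : ℝ) ≤ u}.indicator 1 u ∂lebUnit := by
      intro α
      have hset : Ici (α : ℝ) ∩ Ico 0 1 = Ico (α : ℝ) 1 := by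
        ext u
        exact ⟨fun h => ⟨h.1, h.2.2⟩, fun h => ⟨h.1, α.2.1.trans h.1, h.2⟩⟩
      rw [lintegral_indicator_one (s := {u | (α : ℝ) ≤ u}) measurableSet_Ici, lebUnit,
        Measure.restrict_apply' measurableSet_Ico]
      change _ = volume (Ici (α : ℝ) ∩ Ico 0 1)
      rw [hset, Real.volume_Ico]
    rw [withDensity_apply _ MeasurableSet.univ, Measure.restrict_univ, lintegral_congr h1,
      lintegral_lintegral_swap]
    · have h2 : ∀ᵐ u ∂lebUnit, ∫⁻ α : unitInterval, {u | (α : ℝ) ≤ u}.indicator 1 u ∂m =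
          ENNReal.ofReal (σ u) := by
        refine ae_lebUnit_of_forall fun u hu => ?_
        rw [← hmI u ⟨hu.1.le, hu.2⟩, ← lintegral_indicator_one (hI u)]
        rfl
      have h3 : 0 ≤ᵐ[lebUnit] σ := ae_lebUnit_of_forall fun u hu => hσ.nonneg u ⟨hu.1.le, hu.2⟩
      rw [lintegral_congr_ae h2, ← ofReal_integral_eq_lintegral_ofReal hσ.integrable h3,
        hσ.integral_eq_one, ENNReal.ofReal_one]
    · exact (Measurable.indicator (f := fun _ => (1 : ℝ≥0∞)) measurable_const
        (measurableSet_le (f := fun x : unitInterval × ℝ => (x.1 : ℝ)) (g := Prod.snd)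
          (by fun_prop) (by fun_prop))).aemeasurable
  -- If `σ` is bounded, `m` has an infinite atom at `1`, since `T y = sInf ∅ = 1` for `y` above all
  -- values of `σ`; the density vanishes there and removes it.
  have hone : m.withDensity d {1} = 0 := by
    rw [withDensity_apply _ (measurableSet_singleton 1), lintegral_singleton]
    simp [d]
  refine ⟨⟨⟨m.withDensity d, ⟨hmass⟩⟩, hone⟩, fun u hu => ?_⟩
  have hnn : 0 ≤ᵐ[(m.withDensity d).restrict {α : unitInterval | (α : ℝ) ≤ u}]
      fun α => (1 - (α : ℝ))⁻¹ :=
    Eventually.of_forall fun α => inv_nonneg.2 (sub_nonneg.2 α.2.2)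
  change ∫ α in {α : unitInterval | (α : ℝ) ≤ u}, (1 - (α : ℝ))⁻¹ ∂(m.withDensity d) = σ u
  rw [integral_eq_lintegral_of_nonneg_ae hnn (by fun_prop), restrict_withDensity (hI u),
    lintegral_withDensity_eq_lintegral_mul _ hd (by fun_prop),
    setLIntegral_congr_fun (g := fun _ => 1) (hI u) ?_]
  · rw [setLIntegral_const, one_mul, hmI u hu, ENNReal.toReal_ofReal (hσ.nonneg u hu)]
  · intro α hα
    have : 0 < 1 - (α : ℝ) := sub_pos.2 (lt_of_le_of_lt hα hu.2)
    simp only [d, Pi.mul_apply]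
    rw [← ENNReal.ofReal_mul this.le, mul_inv_cancel₀ this.ne', ENNReal.ofReal_one]

/-! ### Mixtures with the point mass at `0` -/

/-- The mixture `(1 - c) δ₀ + c μ`. -/
lemma exists_mixture (μ : Prob) {c : ℝ} (hc0 : 0 ≤ c) (hc1 : c ≤ 1) :
    ∃ ν : Prob, (ν.1 : Measure unitInterval) =
      ENNReal.ofReal (1 - c) • Measure.dirac (0 : unitInterval) +
        ENNReal.ofReal c • (μ.1 : Measure unitInterval) := by
  refine ⟨⟨⟨ENNReal.ofReal (1 - c) • Measure.dirac (0 : unitInterval) +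
        ENNReal.ofReal c • (μ.1 : Measure unitInterval), ⟨?_⟩⟩, ?_⟩, rfl⟩
  · simp [← ENNReal.ofReal_add (sub_nonneg.2 hc1) hc0]
  · simp [μ.2]

/-- `𝕋` is affine and `𝕋 δ₀ = 1` on `[0, 1)`. -/
lemma spectrumOf_mixture {μ ν : Prob} {c : ℝ} (hc0 : 0 ≤ c) (hc1 : c ≤ 1)
    (h : (ν.1 : Measure unitInterval) =
      ENNReal.ofReal (1 - c) • Measure.dirac (0 : unitInterval) +
        ENNReal.ofReal c • (μ.1 : Measure unitInterval)) {u : ℝ} (hu : u ∈ Ico (0 : ℝ) 1) :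
    spectrumOf ν u = 1 - c + c * spectrumOf μ u := by
  rw [spectrumOf_eq_integral_avarKernel, spectrumOf_eq_integral_avarKernel, h,
    integral_add_measure ((integrable_avarKernel_left _ hu.2).smul_measure (by simp))
      ((integrable_avarKernel_left _ hu.2).smul_measure (by simp)),
    integral_smul_measure, integral_smul_measure, integral_dirac,
    ENNReal.toReal_ofReal (sub_nonneg.2 hc1), ENNReal.toReal_ofReal hc0]
  simp [avarKernel, hu.1]

/-! ### Hölder's inequality and dual functions -/

section Lp

variable {X : Type*} [MeasurableSpace X] {μ : Measure X} {p q : ℝ≥0∞} {f g : X → ℝ}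

lemma integral_mul_le_lpNorm (hpq : ENNReal.HolderConjugate p q) (hf : MemLp f p μ)
    (hg : MemLp g q μ) : ∫ x, f x * g x ∂μ ≤ lpNorm f p μ * lpNorm g q μ := by
  have hi : Integrable (fun x => f x * g x) μ := hf.integrable_mul hg
  have h : eLpNorm (g • f) 1 μ ≤ eLpNorm g q μ * eLpNorm f p μ :=
    haveI := hpq.symm
    eLpNorm_smul_le_mul_eLpNorm hf.1 hg.1
  calc ∫ x, f x * g x ∂μ ≤ ‖∫ x, f x * g x ∂μ‖ := Real.le_norm_self _
    _ ≤ ∫ x, ‖f x * g x‖ ∂μ := norm_integral_le_integral_norm _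
    _ = lpNorm (fun x => f x * g x) 1 μ := (lpNorm_one_eq_integral_norm hi.1).symm
    _ = (eLpNorm (g • f) 1 μ).toReal := by
        rw [← toReal_eLpNorm hi.1]
        congr 2
        ext x
        simp [mul_comm]
    _ ≤ (eLpNorm g q μ * eLpNorm f p μ).toReal :=
        ENNReal.toReal_mono (ENNReal.mul_ne_top hg.2.ne hf.2.ne) h
    _ = lpNorm f p μ * lpNorm g q μ := by
        rw [ENNReal.toReal_mul, toReal_eLpNorm hf.1, toReal_eLpNorm hg.1, mul_comm]

lemma lpNorm_rpow_eq_integral (hp0 : p ≠ 0) (hp : p ≠ ∞) (hf : AEStronglyMeasurable f μ)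
    (hf0 : 0 ≤ᵐ[μ] f) : lpNorm f p μ ^ p.toReal = ∫ x, f x ^ p.toReal ∂μ := by
  have h0 : p.toReal ≠ 0 := (ENNReal.toReal_pos hp0 hp).ne'
  rw [lpNorm_eq_integral_norm_rpow_toReal hp0 hp hf, ← Real.rpow_mul, inv_mul_cancel₀ h0,
    Real.rpow_one]
  · exact integral_congr_ae (hf0.mono fun x hx => by simp only [Real.norm_of_nonneg hx])
  · exact integral_nonneg fun x => by positivity

lemma memLp_div_const (hf : MemLp f p μ) (c : ℝ) : MemLp (fun x => f x / c) p μ := by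
  simpa only [div_eq_inv_mul] using hf.const_mul c⁻¹

lemma lpNorm_const_mul {c : ℝ} (hc : 0 ≤ c) :
    lpNorm (fun x => c * f x) p μ = c * lpNorm f p μ := by
  have := lpNorm_const_smul (p := p) c f μ
  rwa [coe_nnnorm, Real.norm_of_nonneg hc] at this

lemma one_lt_toReal (hp1 : 1 < p) (hp : p ≠ ∞) : 1 < p.toReal := by
  rw [← ENNReal.toReal_one]
  exact ENNReal.toReal_strict_mono hp hp1

lemma conjugate_ne_top (hpq : ENNReal.HolderConjugate p q) (hp1 : 1 < p) : q ≠ ∞ :=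
  (ENNReal.HolderConjugate.ne_top_iff_ne_one q p).2 hp1.ne'

lemma one_lt_conjugate (hpq : ENNReal.HolderConjugate p q) (hp_top : p ≠ ∞) : 1 < q :=
  lt_of_le_of_ne hpq.symm.one_le
    (Ne.symm ((ENNReal.HolderConjugate.ne_top_iff_ne_one p q).1 hp_top))

lemma conjugate_toReal (hpq : ENNReal.HolderConjugate p q) (hp1 : 1 < p) (hp : p ≠ ∞) :
    p.toReal.HolderConjugate q.toReal :=
  ENNReal.HolderConjugate.toReal (one_lt_toReal hp1 hp)

lemma conjugate_mul_sub_one (hpq : ENNReal.HolderConjugate p q) (hp1 : 1 < p) (hp : p ≠ ∞) :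
    q * ENNReal.ofReal (p.toReal - 1) = p := by
  have h := conjugate_toReal hpq hp1 hp
  have hq := conjugate_ne_top hpq hp1
  rw [← ENNReal.ofReal_toReal hq, ← ENNReal.ofReal_mul ENNReal.toReal_nonneg, mul_comm,
    h.sub_one_mul_conj, ENNReal.ofReal_toReal hp]

/-- The dual function `f ^ (p - 1)` of a nonnegative function in `L_p`. -/
lemma memLp_rpow_sub_one (hpq : ENNReal.HolderConjugate p q) (hp1 : 1 < p) (hp : p ≠ ∞)
    (hf0 : 0 ≤ᵐ[μ] f) (hf : MemLp f p μ) :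
    MemLp (fun x => f x ^ (p.toReal - 1)) q μ ∧
      lpNorm (fun x => f x ^ (p.toReal - 1)) q μ = lpNorm f p μ ^ (p.toReal - 1) := by
  have h1 := one_lt_toReal hp1 hp
  have he : eLpNorm (fun x => f x ^ (p.toReal - 1)) q μ = eLpNorm f p μ ^ (p.toReal - 1) := by
    have := eLpNorm_norm_rpow (p := q) (μ := μ) f (sub_pos.2 h1)
    rw [conjugate_mul_sub_one hpq hp1 hp] at this
    rw [← this]
    exact eLpNorm_congr_ae (hf0.mono fun x hx => by simp only [Real.norm_of_nonneg hx])
  have hm : AEStronglyMeasurable (fun x => f x ^ (p.toReal - 1)) μ :=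
    (hf.1.aemeasurable.pow_const _).aestronglyMeasurable
  refine ⟨⟨hm, ?_⟩, ?_⟩
  · rw [he]
    exact ENNReal.rpow_lt_top_of_nonneg (sub_pos.2 h1).le hf.2.ne
  · rw [← toReal_eLpNorm hm, ← toReal_eLpNorm hf.1, he, ENNReal.toReal_rpow]

lemma integral_rpow_sub_one_mul (hp1 : 1 < p) (hp : p ≠ ∞) (hf0 : 0 ≤ᵐ[μ] f)
    (hf : AEStronglyMeasurable f μ) :
    ∫ x, f x ^ (p.toReal - 1) * f x ∂μ = lpNorm f p μ ^ p.toReal := by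
  have h1 := one_lt_toReal hp1 hp
  rw [lpNorm_rpow_eq_integral (zero_lt_one.trans hp1).ne' hp hf hf0]
  refine integral_congr_ae (hf0.mono fun x hx => ?_)
  simp only
  conv_rhs => rw [show p.toReal = p.toReal - 1 + 1 by ring]
  rw [Real.rpow_add_one' hx (by linarith)]

end Lp

/-! ### Norming by spectral functions -/

lemma specNorm_eq_lpNorm {q : ℝ≥0∞} {σ : ℝ → ℝ} (hσ : AEStronglyMeasurable σ lebUnit) :
    specNorm q σ = lpNorm σ q lebUnit := toReal_eLpNorm hσ

/-- `‖σ‖_1 = 1` and `L_q` norms increase with the exponent on a probability space. This makes `lam /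
‖σ‖_q` a legitimate mixing weight. -/
lemma one_le_specNorm {q : ℝ≥0∞} (hq : 1 ≤ q) {σ : ℝ → ℝ} (hσ : IsSpectral σ)
    (hσq : MemLp σ q lebUnit) : 1 ≤ specNorm q σ := by
  have h1 : lpNorm σ 1 lebUnit = 1 := by
    rw [lpNorm_one_eq_integral_norm hσ.integrable.1, ← hσ.integral_eq_one]
    exact integral_congr_ae (ae_lebUnit_of_forall fun u hu =>
      Real.norm_of_nonneg (hσ.nonneg u ⟨hu.1.le, hu.2⟩))
  rw [← h1, specNorm, ← toReal_eLpNorm hσ.integrable.1]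
  exact ENNReal.toReal_mono hσq.2.ne (eLpNorm_le_eLpNorm_of_exponent_le hq hσ.integrable.1)

lemma isSpectral_div {h : ℝ → ℝ} (h0 : ∀ u ∈ Ico (0 : ℝ) 1, 0 ≤ h u)
    (hmono : MonotoneOn h (Ico 0 1)) (hc : ∀ u ∈ Ico (0 : ℝ) 1, ContinuousWithinAt h (Ici u) u)
    (hi : Integrable h lebUnit) (hpos : 0 < ∫ u, h u ∂lebUnit) :
    IsSpectral fun u => h u / ∫ v, h v ∂lebUnit where
  nonneg u hu := div_nonneg (h0 u hu) hpos.le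
  monotoneOn u hu v hv huv := div_le_div_of_nonneg_right (hmono hu hv huv) hpos.le
  rightCont u hu := (hc u hu).div_const _
  integrable := hi.div_const _
  integral_eq_one := by rw [integral_div, div_self hpos.ne']

lemma memLp_one_of_one_le {p : ℝ≥0∞} (hp : 1 ≤ p) {f : ℝ → ℝ} (hf : MemLp f p lebUnit) :
    Integrable f lebUnit := memLp_one_iff_integrable.1 (hf.mono_exponent hp)

lemma integral_pos_of_lpNorm_ne_zero {p : ℝ≥0∞} (hp : 1 ≤ p) {f : ℝ → ℝ}
    (hf0 : 0 ≤ᵐ[lebUnit] f) (hf : MemLp f p lebUnit) (hne : lpNorm f p lebUnit ≠ 0) :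
    0 < ∫ u, f u ∂lebUnit := by
  refine lt_of_le_of_ne (integral_nonneg_of_ae hf0) fun h => hne ?_
  rw [lpNorm_eq_zero hf (zero_lt_one.trans_le hp).ne']
  exact (integral_eq_zero_iff_of_nonneg_ae hf0 (memLp_one_of_one_le hp hf)).1 h.symm

lemma monotone_indicator_Ici (a : ℝ) : Monotone ((Ici a).indicator fun _ => (1 : ℝ)) := by
  intro u v huv
  by_cases hau : a ≤ u
  · rw [indicator_of_mem (s := Ici a) hau, indicator_of_mem (s := Ici a) (hau.trans huv)]
  · rw [indicator_of_notMem (s := Ici a) hau]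
    exact indicator_nonneg (fun _ _ => zero_le_one) v

lemma continuousWithinAt_indicator_Ici (a u : ℝ) :
    ContinuousWithinAt ((Ici a).indicator fun _ => (1 : ℝ)) (Ici u) u := by
  by_cases hau : a ≤ u
  · refine (continuousWithinAt_const (b := (1 : ℝ))).congr (fun w hw => ?_) ?_
    · exact indicator_of_mem (s := Ici a) (hau.trans hw) _
    · exact indicator_of_mem (s := Ici a) hau _
  · refine (continuousWithinAt_const (b := (0 : ℝ))).congr_of_eventuallyEq ?_
      (indicator_of_notMem (s := Ici a) hau _)
    filter_upwards [(eventually_lt_nhds (not_le.1 hau)).filter_mono nhdsWithin_le_nhds] with w hw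
    exact indicator_of_notMem (s := Ici a) (not_le.2 hw) _

lemma integral_indicator_Ici {a : ℝ} (ha : a ∈ Ico (0 : ℝ) 1) :
    ∫ u, (Ici a).indicator (fun _ => (1 : ℝ)) u ∂lebUnit = 1 - a := by
  have hset : Ici a ∩ Ico 0 1 = Ico a 1 := by
    ext u
    exact ⟨fun h => ⟨h.1, h.2.2⟩, fun h => ⟨h.1, ha.1.trans h.1, h.2⟩⟩
  rw [integral_indicator measurableSet_Ici, lebUnit,
    Measure.restrict_restrict measurableSet_Ici, hset]
  simp [ha.2.le]

/-- Every nonnegative nondecreasing right continuous function in `L_p` is normed by a spectral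
function. -/
lemma exists_dual_spectral {p q : ℝ≥0∞} (hp : 1 ≤ p) (hp_top : p ≠ ∞)
    (hpq : ENNReal.HolderConjugate p q) {f : ℝ → ℝ} (h0 : ∀ u ∈ Ico (0 : ℝ) 1, 0 ≤ f u)
    (hmono : MonotoneOn f (Ico 0 1)) (hc : ∀ u ∈ Ico (0 : ℝ) 1, ContinuousWithinAt f (Ici u) u)
    (hf : MemLp f p lebUnit) (hne : lpNorm f p lebUnit ≠ 0) :
    ∃ σ, IsSpectral σ ∧ MemLp σ q lebUnit ∧
      ∫ u, σ u * f u ∂lebUnit = lpNorm σ q lebUnit * lpNorm f p lebUnit ∧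
      ∀ᵐ u ∂lebUnit, f u = 0 → σ u = 0 := by
  have hf0 : 0 ≤ᵐ[lebUnit] f := ae_lebUnit_of_forall fun u hu => h0 u ⟨hu.1.le, hu.2⟩
  rcases hp.eq_or_lt with rfl | hp1
  · have hq : q = ∞ := by
      by_contra h
      exact ((ENNReal.HolderConjugate.ne_top_iff_ne_one q 1).1 h) rfl
    subst hq
    -- For `p = 1` the dual function is the indicator of `{f > 0}`, which by monotonicity is `[a,
    -- 1)` or `(a, 1)`. The closed version is used because it is right continuous.
    set A : Set ℝ := {u | u ∈ Ico (0 : ℝ) 1 ∧ 0 < f u}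
    have hApos : A.Nonempty := by
      by_contra hA
      refine hne ((lpNorm_eq_zero hf one_ne_zero).2 (ae_lebUnit_of_forall fun u hu => ?_))
      by_contra h
      exact hA ⟨u, ⟨hu.1.le, hu.2⟩, lt_of_le_of_ne (h0 u ⟨hu.1.le, hu.2⟩) (Ne.symm h)⟩
    have hbdd : BddBelow A := ⟨0, fun u hu => hu.1.1⟩
    set a := sInf A
    have ha0 : 0 ≤ a := le_csInf hApos fun u hu => hu.1.1
    have ha1 : a < 1 := by
      obtain ⟨u, hu⟩ := hApos
      exact (csInf_le hbdd hu).trans_lt hu.1.2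
    have hlt : ∀ u ∈ Ico (0 : ℝ) 1, u < a → f u = 0 := fun u hu hua => by
      by_contra h
      exact absurd (csInf_le hbdd ⟨hu, lt_of_le_of_ne (h0 u hu) (Ne.symm h)⟩) (not_le.2 hua)
    have hgt : ∀ u ∈ Ico (0 : ℝ) 1, a < u → 0 < f u := fun u hu hau => by
      obtain ⟨v, hv, hvu⟩ := exists_lt_of_csInf_lt hApos hau
      exact hv.2.trans_le (hmono hv.1 hu hvu.le)
    set h : ℝ → ℝ := (Ici a).indicator fun _ => 1
    have hm : Measurable h := measurable_const.indicator measurableSet_Ici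
    have hInt : ∫ u, h u ∂lebUnit = 1 - a := integral_indicator_Ici ⟨ha0, ha1⟩
    have h01 : ∀ u, 0 ≤ h u := fun u => indicator_nonneg (fun _ _ => zero_le_one) u
    have hle : ∀ u, h u ≤ 1 := fun u => indicator_le' (fun _ _ => le_rfl) (fun _ _ => zero_le_one) u
    have hi : MemLp h ∞ lebUnit := memLp_top_of_bound hm.aestronglyMeasurable 1
      (Eventually.of_forall fun u => by rw [Real.norm_of_nonneg (h01 u)]; exact hle u)
    have hpos : 0 < ∫ u, h u ∂lebUnit := by rw [hInt]; linarith
    have hhf : ∀ᵐ u ∂lebUnit, h u * f u = f u := ae_lebUnit_of_forall fun u hu => by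
      rcases lt_or_ge u a with hua | hua
      · simp [hlt u ⟨hu.1.le, hu.2⟩ hua]
      · simp [h, hua]
    -- At `a` itself `f` may vanish while the indicator does not.
    have hae : ∀ᵐ u ∂lebUnit, u ≠ a := by
      rw [lebUnit]
      exact ae_restrict_of_ae (Measure.ae_ne volume a)
    have hσ := isSpectral_div (fun u _ => h01 u) ((monotone_indicator_Ici a).monotoneOn _) (fun u _ => continuousWithinAt_indicator_Ici a u)
      (memLp_one_of_one_le le_top hi) hpos
    refine ⟨_, hσ, memLp_div_const hi _, ?_, ?_⟩
    · refine le_antisymm ?_ ?_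
      · rw [mul_comm (lpNorm _ _ _)]
        simp only [mul_comm _ (f _)]
        exact integral_mul_le_lpNorm hpq hf (memLp_div_const hi _)
      · have h2 : lpNorm (fun u => h u / ∫ v, h v ∂lebUnit) ∞ lebUnit ≤ (∫ v, h v ∂lebUnit)⁻¹ := by
          rw [← toReal_eLpNorm hσ.integrable.1]
          refine ENNReal.toReal_le_of_le_ofReal (inv_nonneg.2 hpos.le) ?_
          rw [eLpNorm_exponent_top]
          refine eLpNormEssSup_le_of_ae_bound (Eventually.of_forall fun u => ?_)
          rw [Real.norm_of_nonneg (div_nonneg (h01 u) hpos.le), div_eq_mul_inv]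
          exact mul_le_of_le_one_left (inv_nonneg.2 hpos.le) (hle u)
        have h3 : ∫ u, h u / (∫ v, h v ∂lebUnit) * f u ∂lebUnit =
            (∫ v, h v ∂lebUnit)⁻¹ * lpNorm f 1 lebUnit := by
          rw [lpNorm_one_eq_integral_norm hf.1, ← integral_const_mul]
          refine integral_congr_ae ?_
          filter_upwards [hhf, hf0] with u hu hu0
          rw [Real.norm_of_nonneg hu0, div_mul_eq_mul_div, hu, div_eq_inv_mul]
        rw [h3]
        exact mul_le_mul_of_nonneg_right h2 lpNorm_nonneg
    · filter_upwards [ae_lebUnit_mem_Ioo, hae] with u hu hua hfu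
      rcases lt_or_gt_of_ne hua with h1 | h1
      · simp [h, h1]
      · exact absurd hfu (hgt u ⟨hu.1.le, hu.2⟩ h1).ne'
  · have h1 := one_lt_toReal hp1 hp_top
    have hq1 : 1 ≤ q := (ENNReal.HolderConjugate.symm (p := p) (q := q)).one_le
    obtain ⟨hm, hnorm⟩ := memLp_rpow_sub_one hpq hp1 hp_top hf0 hf
    -- For `p > 1` the dual function is `f ^ (p - 1)`, monotone and right continuous along with `f`;
    -- it only has to be normalised.
    have hN : 0 < lpNorm f p lebUnit := lt_of_le_of_ne lpNorm_nonneg (Ne.symm hne)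
    set h : ℝ → ℝ := fun u => f u ^ (p.toReal - 1)
    have hh0 : ∀ u ∈ Ico (0 : ℝ) 1, 0 ≤ h u := fun u hu => Real.rpow_nonneg (h0 u hu) _
    have hpos : 0 < ∫ u, h u ∂lebUnit := by
      refine integral_pos_of_lpNorm_ne_zero hq1
        (ae_lebUnit_of_forall fun u hu => hh0 u ⟨hu.1.le, hu.2⟩) hm ?_
      rw [hnorm]
      exact (Real.rpow_pos_of_pos hN _).ne'
    refine ⟨fun u => h u / ∫ v, h v ∂lebUnit, isSpectral_div hh0 ?_ ?_
      (memLp_one_of_one_le hq1 hm) hpos, memLp_div_const hm _, ?_, ?_⟩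
    · exact fun u hu v hv huv =>
        Real.rpow_le_rpow (h0 u hu) (hmono hu hv huv) (sub_pos.2 h1).le
    · exact fun u hu => (hc u hu).rpow_const (Or.inr (sub_pos.2 h1).le)
    · have h2 : lpNorm (fun u => h u / ∫ v, h v ∂lebUnit) q lebUnit =
          (∫ v, h v ∂lebUnit)⁻¹ * lpNorm f p lebUnit ^ (p.toReal - 1) := by
        simp only [div_eq_inv_mul]
        rw [lpNorm_const_mul (inv_nonneg.2 hpos.le), hnorm]
      have h3 := integral_rpow_sub_one_mul hp1 hp_top hf0 hf.1
      rw [h2, mul_assoc, ← Real.rpow_add_one hne, sub_add_cancel, ← h3, ← integral_const_mul]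
      refine integral_congr_ae (Eventually.of_forall fun u => ?_)
      simp only [h]
      ring
    · filter_upwards with u hu
      simp [h, hu, Real.zero_rpow (sub_pos.2 h1).ne']

/-! ### Spectral and Kusuoka representations -/

section Representation

variable {p q : ℝ≥0∞} {lam : ℝ}

lemma integral_mul_sub_const {σ G : ℝ → ℝ} (hσ : Integrable σ lebUnit)
    (hσ1 : ∫ u, σ u ∂lebUnit = 1) (hσG : Integrable (fun u => σ u * G u) lebUnit) (m : ℝ) :
    ∫ u, σ u * (G u - m) ∂lebUnit = ∫ u, σ u * G u ∂lebUnit - m := by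
  simp only [mul_sub]
  rw [integral_sub hσG (hσ.mul_const m), integral_mul_const, hσ1, one_mul]

lemma memLp_posPart_sub {G : ℝ → ℝ} (hG : MemLp G p lebUnit) (m : ℝ) :
    MemLp (fun u => max (G u - m) 0) p lebUnit := (hG.sub (memLp_const m)).pos_part

lemma semideviation_lebUnit {G : ℝ → ℝ} (hG : MemLp G p lebUnit) :
    semideviation lebUnit p lam G = ∫ u, G u ∂lebUnit +
      lam * lpNorm (fun u => max (G u - ∫ v, G v ∂lebUnit) 0) p lebUnit := by
  rw [semideviation, toReal_eLpNorm (memLp_posPart_sub hG _).1]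

/-- Since `σ ≥ 0`, passing from `G - m` to its positive part increases the integral against `σ`;
Hölder then produces the factor `‖σ‖_q`, which cancels the denominator. -/
lemma mixture_le_semideviation (hpq : ENNReal.HolderConjugate p q) (hl0 : 0 ≤ lam)
    {σ G : ℝ → ℝ} (hσ0 : 0 ≤ᵐ[lebUnit] σ) (hσ : Integrable σ lebUnit)
    (hσ1 : ∫ u, σ u ∂lebUnit = 1) (hσq : MemLp σ q lebUnit) (hnorm : 1 ≤ specNorm q σ)
    (hG : MemLp G p lebUnit) :
    (1 - lam / specNorm q σ) * (∫ u, G u ∂lebUnit) +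
      lam / specNorm q σ * ∫ u, σ u * G u ∂lebUnit ≤ semideviation lebUnit p lam G := by
  set m := ∫ u, G u ∂lebUnit
  have hpos := memLp_posPart_sub hG m
  have hσG : Integrable (fun u => σ u * G u) lebUnit := haveI := hpq.symm; hσq.integrable_mul hG
  have hint : Integrable (fun u => σ u * max (G u - m) 0) lebUnit :=
    haveI := hpq.symm; hσq.integrable_mul hpos
  have h1 := integral_mul_sub_const hσ hσ1 hσG m
  have h2 : ∫ u, σ u * (G u - m) ∂lebUnit ≤ ∫ u, σ u * max (G u - m) 0 ∂lebUnit := by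
    refine integral_mono_ae ?_ hint (hσ0.mono fun u hu =>
      mul_le_mul_of_nonneg_left (le_max_left _ _) hu)
    simp only [mul_sub]
    exact hσG.sub (hσ.mul_const m)
  have h3 : ∫ u, σ u * max (G u - m) 0 ∂lebUnit ≤
      specNorm q σ * lpNorm (fun u => max (G u - m) 0) p lebUnit := by
    rw [specNorm_eq_lpNorm hσ.1]
    exact integral_mul_le_lpNorm hpq.symm hσq hpos
  rw [semideviation_lebUnit hG]
  have h4 : lam / specNorm q σ * (∫ u, σ u * G u ∂lebUnit - m) ≤
      lam / specNorm q σ * (specNorm q σ * lpNorm (fun u => max (G u - m) 0) p lebUnit) :=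
    mul_le_mul_of_nonneg_left (by linarith) (by positivity)
  have h5 : lam / specNorm q σ * (specNorm q σ * lpNorm (fun u => max (G u - m) 0) p lebUnit) =
      lam * lpNorm (fun u => max (G u - m) 0) p lebUnit := by
    have : specNorm q σ ≠ 0 := by linarith
    field_simp
  linarith

lemma isSpectral_one : IsSpectral fun _ => 1 where
  nonneg _ _ := zero_le_one
  monotoneOn := monotoneOn_const
  rightCont _ _ := continuousWithinAt_const
  integrable := integrable_const _
  integral_eq_one := by simp

variable {Ω : Type*} [MeasurableSpace Ω] {P : Measure Ω} [IsProbabilityMeasure P] {Z : Ω → ℝ}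

lemma integrable_mul_quantile (hpq : ENNReal.HolderConjugate p q) {σ : ℝ → ℝ}
    (hσq : MemLp σ q lebUnit) (hZ : MemLp Z p P) :
    Integrable (fun u => σ u * quantile P Z u) lebUnit :=
  haveI := hpq.symm
  hσq.integrable_mul (memLp_quantile hZ)

/-- The supremum in the spectral representation of the semideviation is attained. -/
lemma exists_spectral_eq_semideviation (hp : 1 ≤ p) (hp_top : p ≠ ∞)
    (hpq : ENNReal.HolderConjugate p q) (lam : ℝ) (hZ : MemLp Z p P) :
    ∃ σ, IsSpectral σ ∧ MemLp σ q lebUnit ∧ semideviation P p lam Z =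
      (1 - lam / specNorm q σ) * (∫ ω, Z ω ∂P) + lam / specNorm q σ * spectralRisk P σ Z := by
  have hZm := hZ.1.aemeasurable
  have hG := memLp_quantile hZ
  have hq1 : 1 ≤ q := (hpq.symm).one_le
  rw [semideviation_eq_quantile p lam hZm, semideviation_lebUnit hG, ← integral_quantile hZm]
  simp only [spectralRisk]
  set G := quantile P Z
  set m := ∫ u, G u ∂lebUnit
  obtain ⟨Q, hQ, hQmono, hQc, hQm⟩ := exists_monotoneOn_rightCont_max_quantile hZm m
  have hfQ : ∀ u ∈ Ioo (0 : ℝ) 1, Q u - m = max (G u - m) 0 := fun u hu => by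
    rw [hQ u hu, ← max_sub_sub_right, sub_self]
  have hae : (fun u => Q u - m) =ᵐ[lebUnit] fun u => max (G u - m) 0 := ae_lebUnit_of_forall hfQ
  have hf : MemLp (fun u => Q u - m) p lebUnit :=
    (memLp_congr_ae hae).2 (memLp_posPart_sub hG m)
  have hN : lpNorm (fun u => max (G u - m) 0) p lebUnit = lpNorm (fun u => Q u - m) p lebUnit := by
    rw [← toReal_eLpNorm hf.1, ← toReal_eLpNorm (memLp_posPart_sub hG m).1, eLpNorm_congr_ae hae]
  rw [hN]
  by_cases hne : lpNorm (fun u => Q u - m) p lebUnit = 0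
  -- Here `(G - m)₊` is zero, the semideviation reduces to the mean, and the constant spectrum
  -- attains it.
  · refine ⟨fun _ => 1, isSpectral_one, memLp_const 1, ?_⟩
    rw [hne]
    simp only [one_mul]
    change m + lam * 0 = (1 - lam / specNorm q fun _ => 1) * m + lam / (specNorm q fun _ => 1) * m
    ring
  · obtain ⟨σ, hσ, hσq, heq, hzero⟩ := exists_dual_spectral hp hp_top hpq
      (fun u hu => sub_nonneg.2 (hQm u hu)) (fun u hu v hv huv => sub_le_sub_right
        (hQmono hu hv huv) m) (fun u hu => (hQc u hu).sub continuousWithinAt_const) hf hne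
    refine ⟨σ, hσ, hσq, ?_⟩
    have hnorm := one_le_specNorm hq1 hσ hσq
    have h1 := integral_mul_sub_const hσ.integrable hσ.integral_eq_one
      (integrable_mul_quantile hpq hσq hZ) m
    -- Truncation at `m` costs nothing because `σ` vanishes where `G ≤ m`.
    have h2 : ∫ u, σ u * (G u - m) ∂lebUnit = ∫ u, σ u * (Q u - m) ∂lebUnit := by
      refine integral_congr_ae ?_
      filter_upwards [hae, hzero] with u hu hz
      rcases le_or_gt (G u - m) 0 with h | h
      · have : Q u - m = 0 := hu.trans (max_eq_right h)
        simp [hz this]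
      · have : Q u - m = G u - m := hu.trans (max_eq_left h.le)
        simp [this]
    rw [specNorm_eq_lpNorm hσ.integrable.1] at hnorm ⊢
    have h3 : ∫ u, σ u * G u ∂lebUnit =
        m + lpNorm σ q lebUnit * lpNorm (fun u => Q u - m) p lebUnit := by
      rw [← heq, ← h2, h1]
      ring
    have : lpNorm σ q lebUnit ≠ 0 := by linarith
    change _ = (1 - lam / lpNorm σ q lebUnit) * m +
      lam / lpNorm σ q lebUnit * ∫ u, σ u * G u ∂lebUnit
    rw [h3]
    field_simp
    ring

theorem isLUB_semideviation (hp : 1 ≤ p) (hp_top : p ≠ ∞)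
    (hpq : ENNReal.HolderConjugate p q) (hl0 : 0 ≤ lam) (hZ : MemLp Z p P) :
    IsLUB {x : ℝ | ∃ σ : ℝ → ℝ, IsSpectral σ ∧ MemLp σ q lebUnit ∧
        x = (1 - lam / specNorm q σ) * (∫ ω, Z ω ∂P) + lam / specNorm q σ * spectralRisk P σ Z}
      (semideviation P p lam Z) := by
  refine IsGreatest.isLUB ⟨exists_spectral_eq_semideviation hp hp_top hpq lam hZ, ?_⟩
  rintro x ⟨σ, hσ, hσq, rfl⟩
  have hZm := hZ.1.aemeasurable
  rw [semideviation_eq_quantile p lam hZm, ← integral_quantile hZm]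
  exact mixture_le_semideviation hpq hl0
    (ae_lebUnit_of_forall fun u hu => hσ.nonneg u ⟨hu.1.le, hu.2⟩) hσ.integrable hσ.integral_eq_one hσq
    (one_le_specNorm hpq.symm.one_le hσ hσq) (memLp_quantile hZ)

lemma div_specNorm_mem (hq : 1 ≤ q) (hl0 : 0 ≤ lam) (hl1 : lam ≤ 1) {σ : ℝ → ℝ}
    (hσ : IsSpectral σ) (hσq : MemLp σ q lebUnit) :
    0 ≤ lam / specNorm q σ ∧ lam / specNorm q σ ≤ 1 := by
  have h := one_le_specNorm hq hσ hσq
  exact ⟨by positivity, (div_le_one (by linarith)).2 (hl1.trans h)⟩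

lemma spectrumOf_ae_eq_mixture {μ ν : Prob} {c : ℝ} (hc0 : 0 ≤ c) (hc1 : c ≤ 1)
    (h : (ν.1 : Measure unitInterval) =
      ENNReal.ofReal (1 - c) • Measure.dirac (0 : unitInterval) +
        ENNReal.ofReal c • (μ.1 : Measure unitInterval)) :
    spectrumOf ν =ᵐ[lebUnit] fun u => 1 - c + c * spectrumOf μ u :=
  ae_lebUnit_of_forall fun _ hu => spectrumOf_mixture hc0 hc1 h ⟨hu.1.le, hu.2⟩

lemma avar_eq_tailAverage (P : Measure Ω) (Z : Ω → ℝ) (α : ℝ) :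
    avar P α Z = tailAverage (quantile P Z) α := rfl

lemma integral_avar_eq (ν : Prob) (hpq : ENNReal.HolderConjugate p q)
    (hνq : MemLp (spectrumOf ν) q lebUnit) (hZ : MemLp Z p P) :
    Integrable (fun α : unitInterval => avar P α Z) (ν.1 : Measure unitInterval) ∧
      ∫ α, avar P (α : unitInterval) Z ∂(ν.1 : Measure unitInterval) =
        ∫ u, spectrumOf ν u * quantile P Z u ∂lebUnit := by
  simp only [avar_eq_tailAverage]
  exact integral_tailAverage ν (memLp_quantile hZ).1 (integrable_mul_quantile hpq hνq hZ)

lemma memLp_const_add_const_mul {f : ℝ → ℝ} (hf : MemLp f q lebUnit) (a c : ℝ) :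
    MemLp (fun u => a + c * f u) q lebUnit :=
  (memLp_const a).add (hf.const_mul c)

lemma memLp_spectrumOf_of_mem (hq : 1 ≤ q) (hl0 : 0 ≤ lam) (hl1 : lam ≤ 1) {ν : Prob}
    (hν : ν ∈ semideviationSet q lam) : MemLp (spectrumOf ν) q lebUnit := by
  obtain ⟨μ, hμ, h⟩ := hν
  obtain ⟨hc0, hc1⟩ := div_specNorm_mem hq hl0 hl1 (isSpectral_spectrumOf μ) hμ
  exact (memLp_congr_ae (spectrumOf_ae_eq_mixture hc0 hc1 h)).2 (memLp_const_add_const_mul hμ _ _)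

lemma integral_avar_mixture (hp : 1 ≤ p) (hpq : ENNReal.HolderConjugate p q) (hZ : MemLp Z p P)
    {μ ν : Prob} (hμ : MemLp (spectrumOf μ) q lebUnit) {c : ℝ} (hc0 : 0 ≤ c) (hc1 : c ≤ 1)
    (h : (ν.1 : Measure unitInterval) =
      ENNReal.ofReal (1 - c) • Measure.dirac (0 : unitInterval) +
        ENNReal.ofReal c • (μ.1 : Measure unitInterval)) :
    ∫ α, avar P (α : unitInterval) Z ∂(ν.1 : Measure unitInterval) =
      (1 - c) * (∫ ω, Z ω ∂P) + c * spectralRisk P (spectrumOf μ) Z := by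
  have hae := spectrumOf_ae_eq_mixture hc0 hc1 h
  have hνq : MemLp (spectrumOf ν) q lebUnit :=
    (memLp_congr_ae hae).2 (memLp_const_add_const_mul hμ _ _)
  have hGi : Integrable (quantile P Z) lebUnit := memLp_one_of_one_le hp (memLp_quantile hZ)
  rw [(integral_avar_eq ν hpq hνq hZ).2, ← integral_quantile hZ.1.aemeasurable, spectralRisk,
    ← integral_const_mul, ← integral_const_mul, ← integral_add (hGi.const_mul _)
      ((integrable_mul_quantile hpq hμ hZ).const_mul _)]
  refine integral_congr_ae (hae.mono fun u hu => ?_)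
  simp only [hu]
  ring

theorem isKusuokaSet_semideviationSet (hp : 1 ≤ p) (hp_top : p ≠ ∞)
    (hpq : ENNReal.HolderConjugate p q) (hl0 : 0 ≤ lam) (hl1 : lam ≤ 1) :
    IsKusuokaSet P p (semideviation P p lam) (semideviationSet q lam) := by
  intro Z hZ
  have hq1 : 1 ≤ q := hpq.symm.one_le
  refine ⟨fun ν hν => (integral_avar_eq ν hpq (memLp_spectrumOf_of_mem hq1 hl0 hl1 hν) hZ).1, ?_⟩
  -- The two sets of values coincide: a measure gives its spectrum, and a spectral function comes
  -- from a measure by surjectivity of `𝕋`.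
  convert isLUB_semideviation hp hp_top hpq hl0 hZ using 1
  ext x
  constructor
  · rintro ⟨ν, ⟨μ, hμ, h⟩, rfl⟩
    obtain ⟨hc0, hc1⟩ := div_specNorm_mem hq1 hl0 hl1 (isSpectral_spectrumOf μ) hμ
    exact ⟨spectrumOf μ, isSpectral_spectrumOf μ, hμ, integral_avar_mixture hp hpq hZ hμ hc0 hc1 h⟩
  · rintro ⟨σ, hσ, hσq, rfl⟩
    obtain ⟨μ, hμσ⟩ := exists_spectrumOf_eq hσ
    have hae : spectrumOf μ =ᵐ[lebUnit] σ := ae_lebUnit_of_forall fun u hu => hμσ u ⟨hu.1.le, hu.2⟩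
    have hμ : MemLp (spectrumOf μ) q lebUnit := (memLp_congr_ae hae).2 hσq
    obtain ⟨hc0, hc1⟩ := div_specNorm_mem hq1 hl0 hl1 (isSpectral_spectrumOf μ) hμ
    obtain ⟨ν, hν⟩ := exists_mixture μ hc0 hc1
    have hn : specNorm q (spectrumOf μ) = specNorm q σ := by
      rw [specNorm, specNorm, eLpNorm_congr_ae hae]
    have hr : spectralRisk P (spectrumOf μ) Z = spectralRisk P σ Z :=
      integral_congr_ae (hae.mono fun u hu => by simp only [hu])
    refine ⟨ν, ⟨μ, hμ, hν⟩, ?_⟩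
    simp only
    rw [integral_avar_mixture hp hpq hZ hμ hc0 hc1 hν, hn, hr]

end Representation

/-! ### Describing the set by the norm of `𝕋ν` minus a constant -/

variable {p q : ℝ≥0∞} {lam : ℝ}

lemma integral_spectrumOf_sub_const (ν : Prob) (k : ℝ) :
    ∫ u, (spectrumOf ν u - k) ∂lebUnit = 1 - k := by
  rw [integral_sub (integrable_spectrumOf ν) (integrable_const k), integral_spectrumOf]
  simp

/-- With weight `c = lam / ‖𝕋μ‖_q` one has `𝕋ν = (1 - c) + c 𝕋μ`, so `k = 1 - c` works. -/
lemma exists_lpNorm_sub_const_of_mem (hq : 1 ≤ q) (hl0 : 0 ≤ lam) (hl1 : lam ≤ 1) {ν : Prob}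
    (hν : ν ∈ semideviationSet q lam) :
    ∃ k, (∀ u ∈ Ico (0 : ℝ) 1, k ≤ spectrumOf ν u) ∧
      lpNorm (fun u => spectrumOf ν u - k) q lebUnit = lam := by
  obtain ⟨μ, hμ, h⟩ := hν
  have hσ := isSpectral_spectrumOf μ
  have hn := one_le_specNorm hq hσ hμ
  obtain ⟨hc0, hc1⟩ := div_specNorm_mem hq hl0 hl1 hσ hμ
  set c := lam / specNorm q (spectrumOf μ)
  refine ⟨1 - c, fun u hu => ?_, ?_⟩
  · rw [spectrumOf_mixture hc0 hc1 h hu]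
    linarith [mul_nonneg hc0 (spectrumOf_nonneg μ u)]
  · have hae : (fun u => spectrumOf ν u - (1 - c)) =ᵐ[lebUnit] fun u => c * spectrumOf μ u :=
      (spectrumOf_ae_eq_mixture hc0 hc1 h).mono fun u hu => by simp [hu]
    have hm : MemLp (fun u => c * spectrumOf μ u) q lebUnit := hμ.const_mul c
    rw [← toReal_eLpNorm ((memLp_congr_ae hae).2 hm).1, eLpNorm_congr_ae hae,
      toReal_eLpNorm hm.1, lpNorm_const_mul hc0, ← specNorm_eq_lpNorm hμ.1]
    have : specNorm q (spectrumOf μ) ≠ 0 := by linarith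
    simp only [c]
    field_simp

lemma memLp_sub_const {f : ℝ → ℝ} (hf : MemLp f q lebUnit) (k : ℝ) :
    MemLp (fun u => f u - k) q lebUnit := hf.sub (memLp_const k)

/-- For `lam > 0`, `(𝕋ν - k) / (1 - k)` is a spectral function, hence some `𝕋μ`. Its norm is `lam /
(1 - k)`, so the weight prescribed for `μ` is exactly `1 - k`, and mixing restores `ν`. For `lam =
0`, `𝕋ν` is the constant `1`. -/
lemma mem_semideviationSet_of_lpNorm_eq (hq : 1 ≤ q) (hl0 : 0 ≤ lam) (hl1 : lam ≤ 1) {ν : Prob}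
    (hν : MemLp (spectrumOf ν) q lebUnit) {k : ℝ} (hk : ∀ u ∈ Ico (0 : ℝ) 1, k ≤ spectrumOf ν u)
    (hnorm : lpNorm (fun u => spectrumOf ν u - k) q lebUnit = lam) :
    ν ∈ semideviationSet q lam := by
  have hm := memLp_sub_const hν k
  have h1k := integral_spectrumOf_sub_const ν k
  rcases hl0.eq_or_lt with rfl | hl
  · have hae : spectrumOf ν =ᵐ[lebUnit] fun _ => k :=
      ((lpNorm_eq_zero hm (zero_lt_one.trans_le hq).ne').1 hnorm).mono
        fun u hu => sub_eq_zero.1 hu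
    have hk1 : k = 1 := by
      rw [← integral_spectrumOf ν, integral_congr_ae hae]
      simp
    obtain ⟨ν', hν'⟩ := exists_mixture ν le_rfl zero_le_one
    have heq : ν = ν' := by
      refine eq_of_spectrumOf_ae_eq (hae.trans ?_)
      refine (EventuallyEq.symm ?_ : (fun _ => k) =ᵐ[lebUnit] spectrumOf ν')
      exact (spectrumOf_ae_eq_mixture le_rfl zero_le_one hν').mono fun u hu => by simp [hu, hk1]
    refine ⟨ν, hν, ?_⟩
    simp only [zero_div]
    rw [← hν', heq]
  · have hf0 : ∀ u ∈ Ico (0 : ℝ) 1, 0 ≤ spectrumOf ν u - k := fun u hu => sub_nonneg.2 (hk u hu)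
    have hpos := integral_pos_of_lpNorm_ne_zero hq
      (ae_lebUnit_of_forall fun u hu => hf0 u ⟨hu.1.le, hu.2⟩) hm (by rw [hnorm]; exact hl.ne')
    have hs := isSpectral_spectrumOf ν
    have hσ := isSpectral_div hf0 (fun u hu v hv huv => sub_le_sub_right
      (hs.monotoneOn hu hv huv) k) (fun u hu => (hs.rightCont u hu).sub continuousWithinAt_const)
      (memLp_one_of_one_le hq hm) hpos
    rw [h1k] at hσ hpos
    obtain ⟨μ, hμ⟩ := exists_spectrumOf_eq hσ
    have hae : spectrumOf μ =ᵐ[lebUnit] fun u => (1 - k)⁻¹ * (spectrumOf ν u - k) :=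
      ae_lebUnit_of_forall fun u hu => by rw [hμ u ⟨hu.1.le, hu.2⟩, div_eq_inv_mul]
    have hμq : MemLp (spectrumOf μ) q lebUnit := (memLp_congr_ae hae).2 (hm.const_mul _)
    have hn : specNorm q (spectrumOf μ) = (1 - k)⁻¹ * lam := by
      rw [specNorm, eLpNorm_congr_ae hae, toReal_eLpNorm (hm.const_mul _).1,
        lpNorm_const_mul (inv_nonneg.2 hpos.le), hnorm]
    have hc : lam / specNorm q (spectrumOf μ) = 1 - k := by
      rw [hn]
      field_simp
    obtain ⟨hc0, hc1⟩ := div_specNorm_mem hq hl0 hl1 (isSpectral_spectrumOf μ) hμq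
    obtain ⟨ν', hν'⟩ := exists_mixture μ hc0 hc1
    have heq : ν = ν' := by
      refine eq_of_spectrumOf_ae_eq ?_
      filter_upwards [spectrumOf_ae_eq_mixture hc0 hc1 hν', hae] with u h1 h2
      rw [h1, h2, hc, mul_inv_cancel_left₀ hpos.ne']
      ring
    exact ⟨μ, hμq, by rw [heq, hν']⟩

lemma continuous_lpNorm_sub_const (hq : 1 ≤ q) {f : ℝ → ℝ} (hf : MemLp f q lebUnit) :
    Continuous fun k : ℝ => lpNorm (fun u => f u - k) q lebUnit := by
  refine LipschitzWith.continuous (LipschitzWith.of_le_add fun k k' => ?_)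
  have h := lpNorm_add_le (memLp_sub_const hf k') (g := fun _ => k' - k) hq
  rw [lpNorm_const (zero_lt_one.trans_le hq).ne' (NeZero.ne _)] at h
  have heq : (fun u => f u - k') + (fun _ => k' - k) = fun u => f u - k := by
    ext u
    simp
  rw [heq] at h
  simpa [Real.dist_eq, abs_sub_comm] using h

/-- The norm of `𝕋ν - k` is continuous in `k`, at least `1 ≥ lam` at `k = 0` and at most `lam` at `k
= 𝕋ν(0)`; some `k` between gives `lam`. -/
lemma mem_semideviationSet_of_lpNorm_le (hq : 1 ≤ q) (hl0 : 0 ≤ lam) (hl1 : lam ≤ 1) {ν : Prob}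
    (hν : MemLp (spectrumOf ν) q lebUnit)
    (hnorm : lpNorm (fun u => spectrumOf ν u - spectrumOf ν 0) q lebUnit ≤ lam) :
    ν ∈ semideviationSet q lam := by
  have h0 : lam ≤ lpNorm (fun u => spectrumOf ν u - 0) q lebUnit := by
    simp only [sub_zero]
    rw [← specNorm_eq_lpNorm hν.1]
    exact hl1.trans (one_le_specNorm hq (isSpectral_spectrumOf ν) hν)
  obtain ⟨k, hk, hk'⟩ := intermediate_value_Icc' (spectrumOf_nonneg ν 0)
    (continuous_lpNorm_sub_const hq hν).continuousOn ⟨hnorm, h0⟩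
  exact mem_semideviationSet_of_lpNorm_eq hq hl0 hl1 hν (fun u hu => hk.2.trans
    (spectrumOf_monotoneOn ν (mem_Iio.2 zero_lt_one) hu.2 hu.1)) hk'

/-! ### Test functions and weak continuity -/

/-- Nondecreasing right continuous functions that are constant on `[b, ∞)` for some `b` in
`[0, 1)`. -/
structure IsTest (h : ℝ → ℝ) (b : ℝ) : Prop where
  monotone : Monotone h
  rightCont : ∀ u, ContinuousWithinAt h (Ici u) u
  mem : b ∈ Ico (0 : ℝ) 1
  eq_of_le : ∀ u, b ≤ u → h u = h b

/-- The continuous extension to `[0, 1]` of the average value-at-risk of a test function. -/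
noncomputable def testAvar (h : ℝ → ℝ) (b : ℝ) (α : unitInterval) : ℝ :=
  (1 - min (α : ℝ) b)⁻¹ * ∫ τ in (min (α : ℝ) b)..1, h τ

namespace IsTest

variable {h : ℝ → ℝ} {b : ℝ}

lemma norm_le (hh : IsTest h b) {u : ℝ} (hu : 0 ≤ u) : ‖h u‖ ≤ max |h 0| |h b| := by
  have h1 : h u ≤ h b := by
    rcases le_total b u with hbu | hbu
    · exact (hh.eq_of_le u hbu).le
    · exact hh.monotone hbu
  exact abs_le_max_abs_abs (hh.monotone hu) h1

lemma memLp (hh : IsTest h b) : MemLp h p lebUnit :=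
  MemLp.of_bound hh.monotone.measurable.aestronglyMeasurable (max |h 0| |h b|)
    (ae_lebUnit_of_forall fun _ hu => hh.norm_le hu.1.le)

lemma memLp_coe (hh : IsTest h b) :
    MemLp (fun ω : unitInterval => h ω) p (volume : Measure unitInterval) :=
  (hh.memLp (p := p)).comp_measurePreserving measurePreserving_coe_lebUnit

lemma semideviation_coe (hh : IsTest h b) :
    semideviation (volume : Measure unitInterval) p lam (fun ω => h ω) =
      semideviation lebUnit p lam h := by
  rw [semideviation_eq_quantile p lam (hh.memLp_coe (p := 1)).1.aemeasurable]
  have hae := quantile_comp_coe_ae hh.monotone hh.rightCont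
  have hi := integral_congr_ae hae
  rw [semideviation, semideviation, hi]
  congr 3
  exact eLpNorm_congr_ae (hae.mono fun u hu => by simp only [hu])

lemma integrable_mul (hh : IsTest h b) (ν : Prob) :
    Integrable (fun u => spectrumOf ν u * h u) lebUnit :=
  (integrable_spectrumOf ν).mul_bdd (c := max |h 0| |h b|)
    hh.monotone.measurable.aestronglyMeasurable (ae_lebUnit_of_forall fun _ hu => hh.norm_le hu.1.le)

/-- Beyond `b` the test is constant, so all its tail averages there equal the one at `b`; freezing
`α` at `b` removes the singularity at `α = 1`. -/
lemma tailAverage_eq (hh : IsTest h b) {α : unitInterval} (hα : (α : ℝ) < 1) :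
    tailAverage h α = testAvar h b α := by
  have hb := hh.mem
  unfold testAvar
  have hIoc : ∀ a : ℝ, a < 1 → ∫ τ in a..1, h τ = ∫ τ in Ico a 1, h τ := fun a ha => by
    rw [intervalIntegral.integral_of_le ha.le]
    exact setIntegral_congr_set Ico_ae_eq_Ioc.symm
  rw [hIoc _ (min_lt_of_left_lt hα)]
  rcases le_total (α : ℝ) b with h1 | h1
  · rw [min_eq_left h1, tailAverage]
  · have hconst : ∀ a : ℝ, b ≤ a → a < 1 → tailAverage h a = h b := fun a ha ha1 => by
      rw [← tailAverage_const (h b) ha1, tailAverage, tailAverage,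
        setIntegral_congr_fun measurableSet_Ico fun u hu => hh.eq_of_le u (ha.trans hu.1)]
    rw [min_eq_right h1, hconst _ h1 hα]
    exact (hconst b le_rfl hb.2).symm

lemma avar_coe (hh : IsTest h b) {α : ℝ} (hα : 0 ≤ α) :
    avar (volume : Measure unitInterval) α (fun ω => h ω) = tailAverage h α := by
  rw [avar, tailAverage]
  congr 1
  have hae := quantile_comp_coe_ae hh.monotone hh.rightCont
  rw [lebUnit] at hae
  exact integral_congr_ae (ae_restrict_of_ae_restrict_of_subset
    (Ico_subset_Ico_left hα) hae)

lemma continuous_testAvar (hh : IsTest h b) : Continuous (testAvar h b) := by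
  have hb := hh.mem
  have h1 : Continuous fun x : ℝ => ∫ τ in x..1, h τ := by
    have := intervalIntegral.continuous_primitive
      (fun a b => (hh.monotone.intervalIntegrable (μ := volume) (a := a) (b := b))) 1
    exact this.neg.congr fun x => (intervalIntegral.integral_symm 1 x).symm
  have h2 : ∀ α : unitInterval, 1 - min (α : ℝ) b ≠ 0 := fun α => by
    have := min_le_right (α : ℝ) b
    have := hb.2
    intro h
    linarith
  unfold testAvar
  exact ((by fun_prop : Continuous fun α : unitInterval => 1 - min (α : ℝ) b).inv₀ h2).mul
    (h1.comp (by fun_prop))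

lemma integral_testAvar (hh : IsTest h b) (ν : Prob) :
    ∫ α, testAvar h b α ∂(ν.1 : Measure unitInterval) = ∫ u, spectrumOf ν u * h u ∂lebUnit := by
  rw [← (integral_tailAverage ν hh.monotone.measurable.aestronglyMeasurable
    (hh.integrable_mul ν)).2]
  exact integral_congr_ae ((ae_lt_one ν).mono fun α hα => (hh.tailAverage_eq hα).symm)

lemma integral_avar_coe (hh : IsTest h b) (ν : Prob) :
    ∫ α, avar (volume : Measure unitInterval) (α : unitInterval) (fun ω => h ω)
      ∂(ν.1 : Measure unitInterval) = ∫ u, spectrumOf ν u * h u ∂lebUnit := by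
  rw [← (integral_tailAverage ν hh.monotone.measurable.aestronglyMeasurable
    (hh.integrable_mul ν)).2]
  simp only [fun α : unitInterval => hh.avar_coe α.2.1]

lemma continuous_integral_testAvar (hh : IsTest h b) :
    Continuous fun μ : ProbabilityMeasure unitInterval =>
      ∫ α, testAvar h b α ∂(μ : Measure unitInterval) :=
  ProbabilityMeasure.continuous_integral_boundedContinuousFunction
    (BoundedContinuousFunction.mkOfCompact ⟨testAvar h b, hh.continuous_testAvar⟩)

/-- The purpose of tests constant near `1`: their average value-at-risk extends continuously to `[0,
1]`, so integrating it is weakly continuous. -/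
lemma continuous_integral_mul (hh : IsTest h b) :
    Continuous fun ν : Prob => ∫ u, spectrumOf ν u * h u ∂lebUnit := by
  simp only [← hh.integral_testAvar]
  exact hh.continuous_integral_testAvar.comp continuous_subtype_val

end IsTest

lemma isTest_indicator_Ici {a : ℝ} (ha : a ∈ Ico (0 : ℝ) 1) :
    IsTest ((Ici a).indicator fun _ => 1) a where
  monotone := monotone_indicator_Ici a
  rightCont := continuousWithinAt_indicator_Ici a
  mem := ha
  eq_of_le u hu := by simp [hu]

/-- A measure is determined by the integrals of its image under `𝕋` against test functions. -/
lemma eq_of_forall_isTest {μ ν : Prob} (h : ∀ g b, IsTest g b →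
    ∫ u, spectrumOf μ u * g u ∂lebUnit = ∫ u, spectrumOf ν u * g u ∂lebUnit) : μ = ν := by
  refine eq_of_spectrumOf_ae_eq ?_
  -- Indicator tests `1_{[a,1)}` recover the values on half-lines of the measure with density `𝕋κ`,
  -- and hence that measure.
  have hset : ∀ (κ : Prob) (a : ℝ), ENNReal.ofReal (∫ u, spectrumOf κ u *
      (Ici a).indicator (fun _ => 1) u ∂lebUnit) =
      lebUnit.withDensity (fun u => ENNReal.ofReal (spectrumOf κ u)) (Ici a) := fun κ a => by
    have : (fun u => spectrumOf κ u * (Ici a).indicator (fun _ => 1) u) =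
        (Ici a).indicator (spectrumOf κ) := by
      ext u
      by_cases h : a ≤ u <;> simp [indicator, h]
    rw [withDensity_apply _ measurableSet_Ici, this, integral_indicator measurableSet_Ici,
      ofReal_integral_eq_lintegral_ofReal (integrable_spectrumOf κ).integrableOn
        (Eventually.of_forall fun u => spectrumOf_nonneg κ u)]
  have hm : ∀ κ : Prob, AEMeasurable (fun u => ENNReal.ofReal (spectrumOf κ u)) lebUnit :=
    fun κ => (aemeasurable_spectrumOf κ).ennreal_ofReal
  have hfin : ∀ κ : Prob, ∫⁻ u, ENNReal.ofReal (spectrumOf κ u) ∂lebUnit ≠ ∞ := fun κ => by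
    rw [← ofReal_integral_eq_lintegral_ofReal (integrable_spectrumOf κ)
      (Eventually.of_forall fun u => spectrumOf_nonneg κ u)]
    exact ENNReal.ofReal_ne_top
  have hμfin : IsFiniteMeasure (lebUnit.withDensity fun u => ENNReal.ofReal (spectrumOf μ u)) :=
    isFiniteMeasure_withDensity (hfin μ)
  have hmeas : lebUnit.withDensity (fun u => ENNReal.ofReal (spectrumOf μ u)) =
      lebUnit.withDensity fun u => ENNReal.ofReal (spectrumOf ν u) := by
    refine Measure.ext_of_Ici _ _ fun a => ?_
    rw [← hset, ← hset]
    congr 1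
    rcases lt_or_ge a 0 with ha | ha
    · have : ∀ κ : Prob, ∫ u, spectrumOf κ u * (Ici a).indicator (fun _ => 1) u ∂lebUnit = 1 :=
        fun κ => by
          refine Eq.trans (integral_congr_ae (ae_lebUnit_of_forall fun u hu => ?_))
            (integral_spectrumOf κ)
          simp [(ha.trans hu.1).le]
      rw [this, this]
    · rcases lt_or_ge a 1 with ha1 | ha1
      · exact h _ a (isTest_indicator_Ici ⟨ha, ha1⟩)
      · have : ∀ κ : Prob, ∫ u, spectrumOf κ u * (Ici a).indicator (fun _ => 1) u ∂lebUnit = 0 :=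
          fun κ => by
            rw [← integral_zero ℝ ℝ (μ := lebUnit)]
            refine integral_congr_ae (ae_lebUnit_of_forall fun u hu => ?_)
            simp [hu.2.trans_le ha1]
        rw [this, this]
  filter_upwards [(withDensity_eq_iff (hm μ) (hm ν) (hfin μ)).1 hmeas] with u hu
  exact (ENNReal.ofReal_eq_ofReal_iff (spectrumOf_nonneg μ u) (spectrumOf_nonneg ν u)).1 hu

/-! ### Compactness and attainment -/

lemma semideviation_lebUnit_le (hl0 : 0 ≤ lam) {h : ℝ → ℝ} (hh : MemLp h p lebUnit)
    (h0 : 0 ≤ᵐ[lebUnit] h) : semideviation lebUnit p lam h ≤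
      ∫ u, h u ∂lebUnit + lam * lpNorm h p lebUnit := by
  rw [semideviation_lebUnit hh]
  gcongr
  rw [← toReal_eLpNorm (memLp_posPart_sub hh _).1, ← toReal_eLpNorm hh.1]
  refine ENNReal.toReal_mono hh.2.ne (eLpNorm_mono_ae (h0.mono fun u hu => ?_))
  have hm : 0 ≤ ∫ v, h v ∂lebUnit := integral_nonneg_of_ae h0
  have hu' : 0 ≤ h u := hu
  rw [Real.norm_of_nonneg (le_max_right _ _), Real.norm_of_nonneg hu']
  exact max_le (by linarith) hu'

lemma lpNorm_indicator_Ici (hp : 1 ≤ p) (hp_top : p ≠ ∞) {a : ℝ} (ha : a ∈ Ico (0 : ℝ) 1) :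
    lpNorm ((Ici a).indicator fun _ => (1 : ℝ)) p lebUnit = (1 - a) ^ p.toReal⁻¹ := by
  have hp0 : p ≠ 0 := (zero_lt_one.trans_le hp).ne'
  have hpos := ENNReal.toReal_pos hp0 hp_top
  have ht := isTest_indicator_Ici ha
  have h := lpNorm_rpow_eq_integral hp0 hp_top (ht.memLp (p := p)).1
    (Eventually.of_forall fun u => indicator_nonneg (fun _ _ => zero_le_one) u)
  have h1 : (fun u => (Ici a).indicator (fun _ => (1 : ℝ)) u ^ p.toReal) =
      (Ici a).indicator fun _ => (1 : ℝ) := by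
    ext u
    by_cases hau : a ≤ u <;> simp [hau, Real.zero_rpow hpos.ne']
  rw [h1, integral_indicator_Ici ha] at h
  rw [← h, Real.rpow_rpow_inv lpNorm_nonneg hpos.ne']

/-- A closed Kusuoka set is compact. -/
lemma isCompact_of_isKusuokaSet (hp : 1 ≤ p) (hp_top : p ≠ ∞) (hl0 : 0 ≤ lam) {M : Set Prob}
    (hM : IsClosed M) (hK : IsKusuokaSet (volume : Measure unitInterval) p
      (semideviation volume p lam) M) : IsCompact M := by
  rw [Subtype.isCompact_iff]
  -- Probability measures on `[0, 1]` form a compact space; it remains to see that no limit point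
  -- charges `1`.
  suffices h : IsClosed ((↑) '' M : Set (ProbabilityMeasure unitInterval)) from h.isCompact
  refine isClosed_of_closure_subset fun κ hκ => ?_
  -- Use the test `1_{[a,1)}`: its continuous average is nonnegative and equals `1` at `1`, so its
  -- integral dominates the mass at `1`, while on `M` it is at most the semideviation. The bound
  -- passes to the closure and tends to `0` as `a → 1`.
  have hle : ∀ a ∈ Ico (0 : ℝ) 1, (κ : Measure unitInterval).real {1} ≤
      (1 - a) + lam * (1 - a) ^ p.toReal⁻¹ := by
    intro a ha
    have ht := isTest_indicator_Ici ha
    set h : ℝ → ℝ := (Ici a).indicator fun _ => 1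
    have h0 : ∀ u, 0 ≤ h u := fun u => indicator_nonneg (fun _ _ => zero_le_one) u
    have hclosed : IsClosed {μ : ProbabilityMeasure unitInterval |
        ∫ α, testAvar h a α ∂(μ : Measure unitInterval) ≤ (1 - a) + lam * (1 - a) ^ p.toReal⁻¹} :=
      isClosed_le ht.continuous_integral_testAvar continuous_const
    have hmem := closure_minimal (t := {μ : ProbabilityMeasure unitInterval |
        ∫ α, testAvar h a α ∂(μ : Measure unitInterval) ≤ (1 - a) + lam * (1 - a) ^ p.toReal⁻¹})
        ?_ hclosed hκ
    · refine le_trans ?_ hmem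
      have hnn : ∀ α, 0 ≤ testAvar h a α := fun α => by
        have h1 : min (α : ℝ) a ≤ 1 := min_le_of_left_le α.2.2
        exact mul_nonneg (inv_nonneg.2 (sub_nonneg.2 h1))
          (intervalIntegral.integral_nonneg h1 fun u _ => h0 u)
      have hone : testAvar h a 1 = 1 := by
        have h1 : (1 : ℝ) - a ≠ 0 := by linarith [ha.2]
        have h2 : ∫ τ in a..1, h τ = 1 - a := by
          rw [intervalIntegral.integral_of_le ha.2.le,
            setIntegral_congr_fun (g := fun _ => 1) measurableSet_Ioc fun u hu =>
              indicator_of_mem (s := Ici a) hu.1.le _]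
          simp [ha.2.le]
        simp only [testAvar, Icc.coe_one, min_eq_right ha.2.le]
        rw [h2, inv_mul_cancel₀ h1]
      rw [← integral_indicator_one (measurableSet_singleton _)]
      have hbi : Integrable (testAvar h a) (κ : Measure unitInterval) :=
        ht.continuous_testAvar.integrable_of_hasCompactSupport
          (HasCompactSupport.of_compactSpace _)
      refine integral_mono ((integrable_const (1 : ℝ)).indicator (measurableSet_singleton _)) hbi
        fun α => ?_
      by_cases hα : α = 1
      · simp [hα, hone]
      · simpa [hα] using hnn α
    · rintro _ ⟨ν, hν, rfl⟩
      have h1 := (hK _ ht.memLp_coe).2.1 (mem_image_of_mem _ hν)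
      simp only [ht.integral_avar_coe] at h1
      rw [ht.semideviation_coe, ← ht.integral_testAvar] at h1
      refine h1.trans ((semideviation_lebUnit_le hl0 ht.memLp
        (Eventually.of_forall h0)).trans_eq ?_)
      rw [lpNorm_indicator_Ici hp hp_top ha, integral_indicator_Ici ha]
  have hzero : (κ : Measure unitInterval) {1} = 0 := by
    rw [← measureReal_eq_zero_iff]
    refine le_antisymm ?_ measureReal_nonneg
    have hpos := ENNReal.toReal_pos (zero_lt_one.trans_le hp).ne' hp_top
    have hcont : Continuous fun a : ℝ => (1 - a) + lam * (1 - a) ^ p.toReal⁻¹ :=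
      (by fun_prop : Continuous fun a : ℝ => 1 - a).add (continuous_const.mul
        ((by fun_prop : Continuous fun a : ℝ => 1 - a).rpow_const
          fun _ => Or.inr (inv_nonneg.2 hpos.le)))
    have hlim : Tendsto (fun a : ℝ => (1 - a) + lam * (1 - a) ^ p.toReal⁻¹) (𝓝[<] 1) (𝓝 0) := by
      have := hcont.tendsto 1
      simp only [sub_self, Real.zero_rpow (inv_pos.2 hpos).ne', mul_zero, add_zero] at this
      exact this.mono_left nhdsWithin_le_nhds
    refine ge_of_tendsto hlim ?_
    filter_upwards [self_mem_nhdsWithin,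
      (eventually_ge_nhds zero_lt_one).filter_mono nhdsWithin_le_nhds] with a ha1 ha0
    exact hle a ⟨ha0, ha1⟩
  have hcl : (⟨κ, hzero⟩ : Prob) ∈ closure M := closure_subtype.2 hκ
  exact ⟨⟨κ, hzero⟩, hM.closure_subset hcl, rfl⟩

/-- On a closed Kusuoka set the supremum is attained at every test function. -/
lemma exists_eq_semideviation (hp : 1 ≤ p) (hp_top : p ≠ ∞) (hl0 : 0 ≤ lam) {M : Set Prob}
    (hM : IsClosed M) (hK : IsKusuokaSet (volume : Measure unitInterval) p
      (semideviation volume p lam) M) {h : ℝ → ℝ} {b : ℝ} (hh : IsTest h b) :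
    ∃ ν ∈ M, ∫ u, spectrumOf ν u * h u ∂lebUnit = semideviation lebUnit p lam h := by
  have hc := isCompact_of_isKusuokaSet hp hp_top hl0 hM hK
  have hL := (hK _ hh.memLp_coe).2
  simp only [hh.integral_avar_coe] at hL
  rw [hh.semideviation_coe] at hL
  exact hL.mem_of_isClosed hL.nonempty (hc.image hh.continuous_integral_mul).isClosed

/-! ### Equality in Hölder's inequality -/

/-- The equality case of Hölder's inequality. -/
lemma rpow_ae_eq_rpow_of_one_le_integral_mul {X : Type*} [MeasurableSpace X] {μ : Measure X}
    {a b : ℝ} (hab : a.HolderConjugate b) {f g : X → ℝ} (hf0 : 0 ≤ᵐ[μ] f) (hg0 : 0 ≤ᵐ[μ] g)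
    (hf : Integrable (fun x => f x ^ a) μ) (hg : Integrable (fun x => g x ^ b) μ)
    (hfg : Integrable (fun x => f x * g x) μ) (hf1 : ∫ x, f x ^ a ∂μ ≤ 1)
    (hg1 : ∫ x, g x ^ b ∂μ ≤ 1) (hfg1 : 1 ≤ ∫ x, f x * g x ∂μ) :
    (fun x => f x ^ a) =ᵐ[μ] fun x => g x ^ b := by
  -- The gap in Young's inequality is nonnegative and has integral at most `1/a + 1/b - 1 = 0`, so
  -- it vanishes almost everywhere.
  have hD0 : 0 ≤ᵐ[μ] fun x => f x ^ a / a + g x ^ b / b - f x * g x := by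
    filter_upwards [hf0, hg0] with x hx hy
    exact sub_nonneg.2 (Real.young_inequality_of_nonneg hx hy hab)
  have hi : Integrable (fun x => f x ^ a / a + g x ^ b / b) μ :=
    (hf.div_const a).add (hg.div_const b)
  have hD : ∫ x, (f x ^ a / a + g x ^ b / b - f x * g x) ∂μ = 0 := by
    refine le_antisymm ?_ (integral_nonneg_of_ae hD0)
    rw [integral_sub hi hfg, integral_add (hf.div_const a) (hg.div_const b), integral_div,
      integral_div]
    have h1 := div_le_div_of_nonneg_right hf1 hab.nonneg
    have h2 := div_le_div_of_nonneg_right hg1 hab.symm.nonneg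
    have h3 := hab.inv_add_inv_eq_one
    rw [one_div] at h1 h2
    linarith
  filter_upwards [(integral_eq_zero_iff_of_nonneg_ae hD0 (hi.sub hfg)).1 hD, hf0, hg0] with x hx
    hx0 hy0
  exact (Real.young_inequality_eq_iff_of_nonneg hx0 hy0 hab).1 (sub_eq_zero.1 hx).symm

/-! ### Dual test functions of mean zero -/

namespace IsTest

variable {f g : ℝ → ℝ} {b ε : ℝ}

lemma comp (hf : IsTest f b) {φ : ℝ → ℝ} (hφ : MonotoneOn φ (range f)) (hc : Continuous φ) :
    IsTest (fun u => φ (f u)) b where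
  monotone u v huv := hφ (mem_range_self u) (mem_range_self v) (hf.monotone huv)
  rightCont u := hc.continuousAt.comp_continuousWithinAt (hf.rightCont u)
  mem := hf.mem
  eq_of_le u hu := by rw [hf.eq_of_le u hu]

lemma weaken (hf : IsTest f ε) (hb : ε ≤ b) (hb1 : b < 1) : IsTest f b where
  monotone := hf.monotone
  rightCont := hf.rightCont
  mem := ⟨hf.mem.1.trans hb, hb1⟩
  eq_of_le u hu := by rw [hf.eq_of_le u (hb.trans hu), hf.eq_of_le b hb]

lemma add (hf : IsTest f b) (hg : IsTest g b) : IsTest (fun u => f u + g u) b where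
  monotone := hf.monotone.add hg.monotone
  rightCont u := (hf.rightCont u).add (hg.rightCont u)
  mem := hf.mem
  eq_of_le u hu := by rw [hf.eq_of_le u hu, hg.eq_of_le u hu]

lemma mul (hf : IsTest f b) (hg : IsTest g b) (hf0 : ∀ u, 0 ≤ f u) (hg0 : ∀ u, 0 ≤ g u) :
    IsTest (fun u => f u * g u) b where
  monotone := hf.monotone.mul hg.monotone hf0 hg0
  rightCont u := (hf.rightCont u).mul (hg.rightCont u)
  mem := hf.mem
  eq_of_le u hu := by rw [hf.eq_of_le u hu, hg.eq_of_le u hu]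

lemma nonneg (hf : IsTest f b) (hε : 0 < ε) (h0 : ∀ u < ε, f u = 0) (u : ℝ) : 0 ≤ f u := by
  rcases lt_or_ge u ε with h | h
  · exact (h0 u h).ge
  · exact (h0 0 hε).symm.trans_le (hf.monotone (hε.le.trans h))

end IsTest

/-- `𝕋ν` may be unbounded near `1`; clipping its argument to `[0, b]` makes it a test. -/
lemma isTest_spectrumOf_clip (ν : Prob) {b : ℝ} (hb : b ∈ Ico (0 : ℝ) 1) :
    IsTest (fun u => spectrumOf ν (max 0 (min u b))) b := by
  have hlt : ∀ u : ℝ, max 0 (min u b) < 1 := fun u =>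
    max_lt zero_lt_one ((min_le_right _ _).trans_lt hb.2)
  have hmono : Monotone fun u : ℝ => max 0 (min u b) := fun u v huv =>
    max_le_max le_rfl (min_le_min huv le_rfl)
  refine ⟨fun u v huv => spectrumOf_monotoneOn ν (hlt u) (hlt v) (hmono huv), fun u => ?_, hb,
    fun u hu => by rw [min_eq_right hu, min_self]⟩
  exact (spectrumOf_continuousWithinAt ν (hlt u)).comp (f := fun u => max 0 (min u b))
    (by fun_prop : Continuous fun u : ℝ => max 0 (min u b)).continuousWithinAt
    fun v hv => hmono hv

/-- The function `f ^ (q - 1)`, lowered by a constant on `(-∞, ε)` so that its mean is zero. -/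
noncomputable def dualTest (q : ℝ≥0∞) (f : ℝ → ℝ) (ε u : ℝ) : ℝ :=
  f u ^ (q.toReal - 1) + (∫ v, f v ^ (q.toReal - 1) ∂lebUnit) / ε *
    ((Ici ε).indicator (fun _ => 1) u - 1)

section DualTest

variable {f : ℝ → ℝ} {b ε : ℝ}

lemma isTest_rpow (hq : 1 < q) (hq_top : q ≠ ∞) (hf : IsTest f b) (hf0 : ∀ u, 0 ≤ f u) :
    IsTest (fun u => f u ^ (q.toReal - 1)) b := by
  have h1 := sub_pos.2 (one_lt_toReal hq hq_top)
  refine hf.comp ?_ (Real.continuous_rpow_const h1.le)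
  rintro _ ⟨u, rfl⟩ _ ⟨v, rfl⟩ huv
  exact Real.rpow_le_rpow (hf0 u) huv h1.le

lemma isTest_dualTest (hq : 1 < q) (hq_top : q ≠ ∞) (hf : IsTest f b) (hε : 0 < ε) (hεb : ε ≤ b)
    (h0 : ∀ u < ε, f u = 0) : IsTest (dualTest q f ε) b := by
  have hf0 := hf.nonneg hε h0
  refine (isTest_rpow hq hq_top hf hf0).add (((isTest_indicator_Ici ⟨hε.le,
    hεb.trans_lt hf.mem.2⟩).weaken hεb hf.mem.2).comp (φ := fun x =>
    (∫ v, f v ^ (q.toReal - 1) ∂lebUnit) / ε * (x - 1)) (fun x _ y _ hxy => ?_) (by fun_prop))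
  exact mul_le_mul_of_nonneg_left (sub_le_sub_right hxy 1)
    (div_nonneg (integral_nonneg fun u => Real.rpow_nonneg (hf0 u) _) hε.le)

lemma dualTest_of_le {u : ℝ} (hu : ε ≤ u) : dualTest q f ε u = f u ^ (q.toReal - 1) := by
  simp [dualTest, hu]

lemma dualTest_of_lt (hq : 1 < q) (hq_top : q ≠ ∞) (h0 : ∀ u < ε, f u = 0) {u : ℝ} (hu : u < ε) :
    dualTest q f ε u = -((∫ v, f v ^ (q.toReal - 1) ∂lebUnit) / ε) := by
  have h1 := sub_pos.2 (one_lt_toReal hq hq_top)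
  simp [dualTest, hu, h0 u hu, Real.zero_rpow h1.ne']

/-- The lowering happens only on `(-∞, ε)`, where `f` is already zero, so the positive part is
unchanged. -/
lemma max_dualTest (hq : 1 < q) (hq_top : q ≠ ∞) (hε : 0 < ε) (h0 : ∀ u < ε, f u = 0)
    (hf0 : ∀ u, 0 ≤ f u) (u : ℝ) : max (dualTest q f ε u) 0 = f u ^ (q.toReal - 1) := by
  have h1 := sub_pos.2 (one_lt_toReal hq hq_top)
  rcases lt_or_ge u ε with h | h
  · rw [dualTest_of_lt hq hq_top h0 h, h0 u h, Real.zero_rpow h1.ne', max_eq_right]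
    exact neg_nonpos.2 (div_nonneg (integral_nonneg fun u => Real.rpow_nonneg (hf0 u) _) hε.le)
  · rw [dualTest_of_le h, max_eq_left (Real.rpow_nonneg (hf0 u) _)]

/-- Subtracting `I / ε` on an interval of length `ε` removes exactly `I = ∫ f ^ (q - 1)`. -/
lemma integral_dualTest (hq : 1 < q) (hq_top : q ≠ ∞) (hf : IsTest f b) (hε : 0 < ε)
    (hεb : ε ≤ b) (h0 : ∀ u < ε, f u = 0) : ∫ u, dualTest q f ε u ∂lebUnit = 0 := by
  have hmem : ε ∈ Ico (0 : ℝ) 1 := ⟨hε.le, hεb.trans_lt hf.mem.2⟩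
  have hi := ((isTest_indicator_Ici hmem).memLp (p := 1)).integrable le_rfl
  have hg := ((isTest_rpow hq hq_top hf (hf.nonneg hε h0)).memLp (p := 1)).integrable le_rfl
  have hs : Integrable (fun u => (Ici ε).indicator (fun _ => (1 : ℝ)) u - 1) lebUnit :=
    hi.sub (integrable_const 1)
  unfold dualTest
  rw [integral_add hg (hs.const_mul _), integral_const_mul,
    integral_sub hi (integrable_const 1), integral_indicator_Ici hmem]
  simp only [integral_const, probReal_univ, smul_eq_mul, mul_one]
  field_simp
  ring

/-- With mean zero, only `lam` times the `L_p` norm of the positive part `f ^ (q - 1)` remains, and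
that norm is `‖f‖_q ^ (q - 1)`. -/
lemma semideviation_dualTest (hp : 1 < p) (hp_top : p ≠ ∞) (hpq : ENNReal.HolderConjugate p q)
    (hf : IsTest f b) (hε : 0 < ε) (hεb : ε ≤ b) (h0 : ∀ u < ε, f u = 0) :
    semideviation lebUnit p lam (dualTest q f ε) =
      lam * lpNorm f q lebUnit ^ (q.toReal - 1) := by
  have hq_top := conjugate_ne_top hpq hp
  have hq := one_lt_conjugate hpq hp_top
  have hf0 := hf.nonneg hε h0
  rw [semideviation_lebUnit (isTest_dualTest hq hq_top hf hε hεb h0).memLp,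
    integral_dualTest hq hq_top hf hε hεb h0]
  simp only [sub_zero, max_dualTest hq hq_top hε h0 hf0, zero_add]
  rw [(memLp_rpow_sub_one hpq.symm hq hq_top (Eventually.of_forall hf0) hf.memLp).2]

end DualTest

/-! ### From domination on tests to a norm bound -/

/-- The clipped excess of `𝕋 ν` over one of its values. -/
noncomputable def clippedExcess (ν : Prob) (ε b u : ℝ) : ℝ :=
  max (spectrumOf ν (max 0 (min u b)) - spectrumOf ν ε) 0

/-- Testing `ν` against the dual test of the clipped excess `f` gives `‖f‖_q ^ q ≤ ∫ 𝕋ν · g ≤ lam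
‖f‖_q ^ (q - 1)`; divide. -/
lemma lpNorm_clippedExcess_le (hp : 1 < p) (hp_top : p ≠ ∞) (hpq : ENNReal.HolderConjugate p q)
    (hl0 : 0 ≤ lam) {ν : Prob} (h : ∀ g b, IsTest g b →
      ∫ u, spectrumOf ν u * g u ∂lebUnit ≤ semideviation lebUnit p lam g)
    {ε b : ℝ} (hε : 0 < ε) (hεb : ε ≤ b) (hb : b < 1) :
    IsTest (clippedExcess ν ε b) b ∧ lpNorm (clippedExcess ν ε b) q lebUnit ≤ lam := by
  have hq_top := conjugate_ne_top hpq hp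
  have hq := one_lt_conjugate hpq hp_top
  have hb' : b ∈ Ico (0 : ℝ) 1 := ⟨hε.le.trans hεb, hb⟩
  set f := clippedExcess ν ε b
  have hf : IsTest f b := (isTest_spectrumOf_clip ν hb').comp
    (φ := fun x => max (x - spectrumOf ν ε) 0)
    (fun x _ y _ hxy => max_le_max (sub_le_sub_right hxy _) le_rfl) (by fun_prop)
  have hclip : ∀ u : ℝ, max 0 (min u b) < 1 := fun u =>
    max_lt zero_lt_one ((min_le_right _ _).trans_lt hb)
  have h0 : ∀ u < ε, f u = 0 := fun u hu => max_eq_right (sub_nonpos.2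
    (spectrumOf_monotoneOn ν (hclip u) (hεb.trans_lt hb)
      (max_le hε.le ((min_le_left _ _).trans hu.le))))
  refine ⟨hf, ?_⟩
  have hf0 := hf.nonneg hε h0
  have ht := isTest_dualTest hq hq_top hf hε hεb h0
  have hle := h _ _ ht
  rw [semideviation_dualTest hp hp_top hpq hf hε hεb h0] at hle
  have hint := integral_dualTest hq hq_top hf hε hεb h0
  have h1 : ∫ u, f u ^ (q.toReal - 1) * f u ∂lebUnit ≤
      ∫ u, spectrumOf ν u * dualTest q f ε u ∂lebUnit := by
    -- As the test has mean zero, `𝕋ν` may be replaced by `𝕋ν - 𝕋ν(ε)`. This has the same sign as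
    -- the test: both are nonpositive below `ε` and nonnegative above.
    have heq : ∫ u, spectrumOf ν u * dualTest q f ε u ∂lebUnit =
        ∫ u, (spectrumOf ν u - spectrumOf ν ε) * dualTest q f ε u ∂lebUnit := by
      simp only [sub_mul]
      rw [integral_sub (ht.integrable_mul ν)
        (((ht.memLp (p := 1)).integrable le_rfl).const_mul _), integral_const_mul, hint]
      simp
    rw [heq]
    refine integral_mono_ae ((((isTest_rpow hq hq_top hf hf0).mul hf
      (fun u => Real.rpow_nonneg (hf0 u) _) hf0).memLp (p := 1)).integrable le_rfl) ?_
      (ae_lebUnit_of_forall fun u hu => ?_)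
    · simp only [sub_mul]
      exact (ht.integrable_mul ν).sub (((ht.memLp (p := 1)).integrable le_rfl).const_mul _)
    · rcases lt_or_ge u ε with hue | hue
      · simp only [h0 u hue, mul_zero, dualTest_of_lt hq hq_top h0 hue]
        refine mul_nonneg_of_nonpos_of_nonpos (sub_nonpos.2 (spectrumOf_monotoneOn ν hu.2
          (hεb.trans_lt hb) hue.le)) ?_
        exact neg_nonpos.2
          (div_nonneg (integral_nonneg fun u => Real.rpow_nonneg (hf0 u) _) hε.le)
      · simp only [dualTest_of_le hue]
        rw [mul_comm]
        refine mul_le_mul_of_nonneg_right (max_le (sub_le_sub_right (spectrumOf_monotoneOn ν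
          (hclip u) hu.2 (max_le hu.1.le (min_le_left _ _))) _) (sub_nonneg.2
          (spectrumOf_monotoneOn ν (hεb.trans_lt hb) hu.2 hue))) (Real.rpow_nonneg (hf0 u) _)
  rw [integral_rpow_sub_one_mul hq hq_top (Eventually.of_forall hf0) (hf.memLp (p := 1)).1] at h1
  rcases (lpNorm_nonneg (f := f) (p := q) (μ := lebUnit)).eq_or_lt with hN | hN
  · exact hN.symm.trans_le hl0
  · have h2 := h1.trans hle
    rw [show q.toReal = q.toReal - 1 + 1 by ring, Real.rpow_add_one hN.ne', add_sub_cancel_right,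
      mul_comm] at h2
    exact le_of_mul_le_mul_right h2 (Real.rpow_pos_of_pos hN _)

lemma clip_eq {u b : ℝ} (hu : 0 ≤ u) (hb : u ≤ b) : max 0 (min u b) = u := by
  rw [min_eq_left hb, max_eq_right hu]

lemma level_pos (n : ℕ) : (0 : ℝ) < 1 / ((n : ℝ) + 2) := by positivity

lemma level_le (n : ℕ) : 1 / ((n : ℝ) + 2) ≤ 1 - 1 / ((n : ℝ) + 2) := by
  have : 1 / ((n : ℝ) + 2) ≤ 1 / 2 :=
    one_div_le_one_div_of_le two_pos (by linarith [n.cast_nonneg (α := ℝ)])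
  linarith

lemma tendsto_level : Tendsto (fun n : ℕ => 1 / ((n : ℝ) + 2)) atTop (𝓝 0) :=
  tendsto_const_nhds.div_atTop (tendsto_atTop_add_const_right _ _ tendsto_natCast_atTop_atTop)

lemma eventually_level {u : ℝ} (hu : u ∈ Ioo (0 : ℝ) 1) :
    ∀ᶠ n : ℕ in atTop, 1 / ((n : ℝ) + 2) ≤ u ∧ u ≤ 1 - 1 / ((n : ℝ) + 2) := by
  filter_upwards [tendsto_level.eventually (eventually_le_nhds hu.1),
    tendsto_level.eventually (eventually_le_nhds (sub_pos.2 hu.2))] with n h1 h2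
  exact ⟨h1, by linarith⟩

/-- A measure whose integrals against test functions are dominated by the semideviation. -/
lemma lpNorm_sub_le_of_forall_isTest (hp : 1 < p) (hp_top : p ≠ ∞)
    (hpq : ENNReal.HolderConjugate p q) (hl0 : 0 ≤ lam) {ν : Prob} (h : ∀ g b, IsTest g b →
      ∫ u, spectrumOf ν u * g u ∂lebUnit ≤ semideviation lebUnit p lam g) :
    MemLp (spectrumOf ν) q lebUnit ∧
      lpNorm (fun u => spectrumOf ν u - spectrumOf ν 0) q lebUnit ≤ lam := by
  have hb : ∀ n : ℕ, 1 - 1 / ((n : ℝ) + 2) < 1 := fun n => by linarith [level_pos n]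
  have hn := fun n : ℕ =>
    lpNorm_clippedExcess_le hp hp_top hpq hl0 h (level_pos n) (level_le n) (hb n)
  have hlim : ∀ᵐ u ∂lebUnit, Tendsto (fun n : ℕ => clippedExcess ν (1 / ((n : ℝ) + 2))
      (1 - 1 / ((n : ℝ) + 2)) u) atTop (𝓝 (spectrumOf ν u - spectrumOf ν 0)) := by
    refine ae_lebUnit_of_forall fun u hu => ?_
    have h1 : Tendsto (fun n : ℕ => spectrumOf ν (1 / ((n : ℝ) + 2))) atTop
        (𝓝 (spectrumOf ν 0)) :=
      (spectrumOf_continuousWithinAt ν zero_lt_one).tendsto.comp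
        (tendsto_nhdsWithin_iff.2 ⟨tendsto_level, Eventually.of_forall fun n => (level_pos n).le⟩)
    have h2 : Tendsto (fun n : ℕ => max (spectrumOf ν u - spectrumOf ν (1 / ((n : ℝ) + 2))) 0)
        atTop (𝓝 (max (spectrumOf ν u - spectrumOf ν 0) 0)) :=
      (tendsto_const_nhds.sub h1).max tendsto_const_nhds
    rw [max_eq_left (sub_nonneg.2 (spectrumOf_monotoneOn ν (mem_Iio.2 zero_lt_one) hu.2
      hu.1.le))] at h2
    refine h2.congr' ((eventually_level hu).mono fun n hn => ?_)
    simp only [clippedExcess, clip_eq hu.1.le hn.2]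
  -- Fatou's lemma; no integrability of `𝕋ν` in `L_q` is known beforehand.
  have hle : eLpNorm (fun u => spectrumOf ν u - spectrumOf ν 0) q lebUnit ≤ ENNReal.ofReal lam :=
    Lp.eLpNorm_le_of_ae_tendsto (Eventually.of_forall fun n => by
      have hm := (hn n).1.memLp (p := q)
      rw [ENNReal.le_ofReal_iff_toReal_le hm.2.ne hl0, toReal_eLpNorm hm.1]
      exact (hn n).2) (fun n => ((hn n).1.memLp (p := q)).1) hlim
  have hm : MemLp (fun u => spectrumOf ν u - spectrumOf ν 0) q lebUnit :=
    ⟨((aemeasurable_spectrumOf ν).sub aemeasurable_const).aestronglyMeasurable,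
      hle.trans_lt ENNReal.ofReal_lt_top⟩
  refine ⟨?_, ?_⟩
  · have := hm.add (memLp_const (spectrumOf ν 0))
    refine (memLp_congr_ae (Eventually.of_forall fun u => ?_)).1 this
    simp
  · rw [← toReal_eLpNorm hm.1]
    exact ENNReal.toReal_le_of_le_ofReal hl0 hle

/-! ### Measures attaining a dual test, and approximation -/

lemma integrable_rpow_of_memLp {X : Type*} [MeasurableSpace X] {μ : Measure X} {f : X → ℝ}
    (hq0 : q ≠ 0) (hq : q ≠ ∞) (hf0 : 0 ≤ᵐ[μ] f) (hf : MemLp f q μ) :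
    Integrable (fun x => f x ^ q.toReal) μ :=
  (hf.integrable_norm_rpow hq0 hq).congr
    (hf0.mono fun x hx => by simp only [Real.norm_of_nonneg hx])

/-- A measure attaining the semideviation of a dual test function is determined up to its atom
at `0`. -/
lemma spectrumOf_ae_eq_of_attained (hp : 1 < p) (hp_top : p ≠ ∞)
    (hpq : ENNReal.HolderConjugate p q) (hl : 0 < lam) {ν : Prob}
    (hν : MemLp (spectrumOf ν) q lebUnit)
    (hnorm : lpNorm (fun u => spectrumOf ν u - spectrumOf ν 0) q lebUnit ≤ lam)
    {f : ℝ → ℝ} {b ε : ℝ} (hf : IsTest f b) (hε : 0 < ε) (hεb : ε ≤ b) (h0 : ∀ u < ε, f u = 0)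
    (hF : 0 < lpNorm f q lebUnit) (hatt : ∫ u, spectrumOf ν u * dualTest q f ε u ∂lebUnit =
      semideviation lebUnit p lam (dualTest q f ε)) :
    spectrumOf ν =ᵐ[lebUnit] fun u => spectrumOf ν 0 + lam / lpNorm f q lebUnit * f u := by
  have hq_top := conjugate_ne_top hpq hp
  have hq := one_lt_conjugate hpq hp_top
  have hq0 : q ≠ 0 := (zero_lt_one.trans hq).ne'
  have hp0 : p ≠ 0 := (zero_lt_one.trans hp).ne'
  have hconj := conjugate_toReal hpq.symm hq hq_top
  have hf0 := hf.nonneg hε h0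
  have ht := isTest_dualTest hq hq_top hf hε hεb h0
  rw [semideviation_dualTest hp hp_top hpq hf hε hεb h0] at hatt
  set F := lpNorm f q lebUnit
  set x : ℝ → ℝ := fun u => spectrumOf ν u - spectrumOf ν 0
  have hx : MemLp x q lebUnit := memLp_sub_const hν _
  have hx0 : ∀ u ∈ Ioo (0 : ℝ) 1, 0 ≤ x u := fun u hu => sub_nonneg.2
    (spectrumOf_monotoneOn ν (mem_Iio.2 zero_lt_one) hu.2 hu.1.le)
  have hxt : ∀ {g : ℝ → ℝ} {b : ℝ}, IsTest g b → Integrable (fun u => x u * g u) lebUnit :=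
    fun hg => by
      simp only [x, sub_mul]
      exact (hg.integrable_mul ν).sub (((hg.memLp (p := 1)).integrable le_rfl).const_mul _)
  have hg := isTest_rpow hq hq_top hf hf0
  have hxg : lam * F ^ (q.toReal - 1) ≤ ∫ u, x u * f u ^ (q.toReal - 1) ∂lebUnit := by
    have h1 : ∫ u, x u * dualTest q f ε u ∂lebUnit = lam * F ^ (q.toReal - 1) := by
      simp only [x, sub_mul]
      rw [integral_sub (ht.integrable_mul ν) (((ht.memLp (p := 1)).integrable le_rfl).const_mul _),
        integral_const_mul, integral_dualTest hq hq_top hf hε hεb h0, hatt]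
      simp
    rw [← h1]
    refine integral_mono_ae (hxt ht) (hxt hg) (ae_lebUnit_of_forall fun u hu => ?_)
    simp only
    rw [← max_dualTest hq hq_top hε h0 hf0 u]
    exact mul_le_mul_of_nonneg_left (le_max_left _ _) (hx0 u hu)
  -- Normalisation: `X` has `L_q` norm at most `1`, `Y` is the dual of the unit vector `W`, and
  -- attainment gives `∫ X Y ≥ 1`. Equality in Hölder yields `X ^ q = Y ^ p = W ^ q`.
  set X : ℝ → ℝ := fun u => lam⁻¹ * x u
  set W : ℝ → ℝ := fun u => F⁻¹ * f u
  set Y : ℝ → ℝ := fun u => W u ^ (q.toReal - 1)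
  have hX : MemLp X q lebUnit := hx.const_mul _
  have hW : MemLp W q lebUnit := (hf.memLp).const_mul _
  have hX0 : 0 ≤ᵐ[lebUnit] X := ae_lebUnit_of_forall fun u hu => mul_nonneg (inv_nonneg.2 hl.le) (hx0 u hu)
  have hW0 : ∀ u, 0 ≤ W u := fun u => mul_nonneg (inv_nonneg.2 hF.le) (hf0 u)
  have hY0 : ∀ u, 0 ≤ Y u := fun u => Real.rpow_nonneg (hW0 u) _
  obtain ⟨hY, hYn⟩ := memLp_rpow_sub_one hpq.symm hq hq_top (Eventually.of_forall hW0) hW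
  have hXn : lpNorm X q lebUnit ≤ 1 := by
    rw [lpNorm_const_mul (inv_nonneg.2 hl.le)]
    exact (inv_mul_le_one₀ hl).2 hnorm
  have hWn : lpNorm W q lebUnit = 1 := by
    rw [lpNorm_const_mul (inv_nonneg.2 hF.le)]
    exact inv_mul_cancel₀ hF.ne'
  rw [hWn, Real.one_rpow] at hYn
  have hYeq : ∀ u, Y u = (F ^ (q.toReal - 1))⁻¹ * f u ^ (q.toReal - 1) := fun u => by
    simp only [Y, W]
    rw [Real.mul_rpow (inv_nonneg.2 hF.le) (hf0 u), Real.inv_rpow hF.le]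
  have hXYeq : ∀ u, X u * Y u =
      lam⁻¹ * (F ^ (q.toReal - 1))⁻¹ * (x u * f u ^ (q.toReal - 1)) := fun u => by
    rw [hYeq]
    simp only [X]
    ring
  have hFpos : 0 < F ^ (q.toReal - 1) := Real.rpow_pos_of_pos hF _
  have key := rpow_ae_eq_rpow_of_one_le_integral_mul hconj hX0 (Eventually.of_forall hY0)
    (integrable_rpow_of_memLp hq0 hq_top hX0 hX)
    (integrable_rpow_of_memLp hp0 hp_top (Eventually.of_forall hY0) hY)
    (by simp only [hXYeq]; exact (hxt hg).const_mul _)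
    (by rw [← lpNorm_rpow_eq_integral hq0 hq_top hX.1 hX0]
        exact Real.rpow_le_one lpNorm_nonneg hXn ENNReal.toReal_nonneg)
    (by rw [← lpNorm_rpow_eq_integral hp0 hp_top hY.1 (Eventually.of_forall hY0), hYn,
          Real.one_rpow])
    (by simp only [hXYeq]
        rw [integral_const_mul]
        refine le_trans (le_of_eq ?_) (mul_le_mul_of_nonneg_left hxg (by positivity))
        field_simp)
  filter_upwards [key, hX0] with u hu hXu
  have hWX : W u = X u := by
    simp only [Y] at hu
    rw [← Real.rpow_mul (hW0 u), hconj.sub_one_mul_conj] at hu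
    exact ((Real.rpow_left_inj (hXu) (hW0 u) hconj.ne_zero).1 hu).symm
  have h1 : x u = lam * (F⁻¹ * f u) := by
    rw [show F⁻¹ * f u = lam⁻¹ * x u from hWX, mul_inv_cancel_left₀ hl.ne']
  have h2 : spectrumOf ν u = spectrumOf ν 0 + x u := by simp [x]
  rw [h2, h1]
  ring

lemma ae_eq_one_of_ae_eq_const {ν : Prob} {k : ℝ} (h : spectrumOf ν =ᵐ[lebUnit] fun _ => k) :
    spectrumOf ν =ᵐ[lebUnit] fun _ => 1 := by
  have hk := integral_spectrumOf ν
  rw [integral_congr_ae h] at hk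
  simp only [integral_const, probReal_univ, one_smul] at hk
  rwa [hk] at h

/-- Approximation of `𝕋 ν - k` from below by test functions that vanish near `0`. -/
noncomputable def approxExcess (ν : Prob) (k : ℝ) (n : ℕ) (u : ℝ) : ℝ :=
  (Ici (1 / ((n : ℝ) + 2))).indicator (fun _ => 1) u *
    (spectrumOf ν (max 0 (min u (1 - 1 / ((n : ℝ) + 2)))) - k)

section ApproxExcess

variable {ν : Prob} {k : ℝ}

lemma one_sub_level_mem (n : ℕ) : 1 - 1 / ((n : ℝ) + 2) ∈ Ico (0 : ℝ) 1 :=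
  ⟨(level_pos n).le.trans (level_le n), by linarith [level_pos n]⟩

lemma isTest_approxExcess (hk : ∀ u ∈ Ico (0 : ℝ) 1, k ≤ spectrumOf ν u) (n : ℕ) :
    IsTest (approxExcess ν k n) (1 - 1 / ((n : ℝ) + 2)) := by
  have hb := one_sub_level_mem n
  refine IsTest.mul ((isTest_indicator_Ici ⟨(level_pos n).le, (level_le n).trans_lt hb.2⟩).weaken
    (level_le n) hb.2) ((isTest_spectrumOf_clip ν hb).comp (φ := fun x => x - k)
    (fun x _ y _ hxy => sub_le_sub_right hxy k) (by fun_prop))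
    (fun u => indicator_nonneg (fun _ _ => zero_le_one) u) fun u => sub_nonneg.2 (hk _
      ⟨le_max_left _ _, max_lt zero_lt_one ((min_le_right _ _).trans_lt hb.2)⟩)

lemma approxExcess_of_lt (n : ℕ) : ∀ u < 1 / ((n : ℝ) + 2), approxExcess ν k n u = 0 :=
  fun u hu => by
    rw [approxExcess, indicator_of_notMem (s := Ici (1 / ((n : ℝ) + 2))) (not_le.2 hu), zero_mul]

lemma approxExcess_nonneg (hk : ∀ u ∈ Ico (0 : ℝ) 1, k ≤ spectrumOf ν u) (n : ℕ) (u : ℝ) :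
    0 ≤ approxExcess ν k n u :=
  (isTest_approxExcess hk n).nonneg (level_pos n) (approxExcess_of_lt n) u

lemma approxExcess_le (hk : ∀ u ∈ Ico (0 : ℝ) 1, k ≤ spectrumOf ν u) (n : ℕ) {u : ℝ}
    (hu : u ∈ Ioo (0 : ℝ) 1) : approxExcess ν k n u ≤ spectrumOf ν u - k := by
  have hb := one_sub_level_mem n
  have h1 : 0 ≤ spectrumOf ν u - k := sub_nonneg.2 (hk u ⟨hu.1.le, hu.2⟩)
  by_cases h : 1 / ((n : ℝ) + 2) ≤ u
  · rw [approxExcess, indicator_of_mem (s := Ici (1 / ((n : ℝ) + 2))) h, one_mul]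
    exact sub_le_sub_right (spectrumOf_monotoneOn ν
      (max_lt zero_lt_one ((min_le_right _ _).trans_lt hb.2)) hu.2
      (max_le hu.1.le (min_le_left _ _))) k
  · exact (approxExcess_of_lt n u (not_le.1 h)).trans_le h1

lemma tendsto_approxExcess {u : ℝ} (hu : u ∈ Ioo (0 : ℝ) 1) :
    Tendsto (fun n => approxExcess ν k n u) atTop (𝓝 (spectrumOf ν u - k)) := by
  refine tendsto_const_nhds.congr' ((eventually_level hu).mono fun n hn => ?_)
  simp only [approxExcess, clip_eq hu.1.le hn.2]
  rw [indicator_of_mem (s := Ici (1 / ((n : ℝ) + 2))) hn.1, one_mul]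

lemma tendsto_integral_approxExcess_mul (hk : ∀ u ∈ Ico (0 : ℝ) 1, k ≤ spectrumOf ν u)
    {g : ℝ → ℝ} {b : ℝ} (hg : IsTest g b) :
    Tendsto (fun n => ∫ u, approxExcess ν k n u * g u ∂lebUnit) atTop
      (𝓝 (∫ u, spectrumOf ν u * g u ∂lebUnit - k * ∫ u, g u ∂lebUnit)) := by
  have hgi := (hg.memLp (p := 1)).integrable le_rfl
  have hi : Integrable (fun u => (spectrumOf ν u - k) * g u) lebUnit := by
    simp only [sub_mul]
    exact (hg.integrable_mul ν).sub (hgi.const_mul k)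
  rw [← integral_const_mul, ← integral_sub (hg.integrable_mul ν) (hgi.const_mul k)]
  simp only [← sub_mul]
  refine tendsto_integral_of_dominated_convergence (fun u => ‖(spectrumOf ν u - k) * g u‖)
    (fun n => ((isTest_approxExcess hk n).monotone.measurable.mul
      hg.monotone.measurable).aestronglyMeasurable) hi.norm (fun n => ae_lebUnit_of_forall fun u hu => ?_)
    (ae_lebUnit_of_forall fun u hu => (tendsto_approxExcess hu).mul_const _)
  rw [norm_mul, norm_mul]
  refine mul_le_mul_of_nonneg_right ?_ (norm_nonneg _)
  have h1 := approxExcess_nonneg hk n u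
  have h2 := approxExcess_le hk n hu
  rw [Real.norm_of_nonneg h1, Real.norm_of_nonneg (h1.trans h2)]
  exact h2

lemma tendsto_lpNorm_approxExcess (hq : 1 < q) (hq_top : q ≠ ∞)
    (hk : ∀ u ∈ Ico (0 : ℝ) 1, k ≤ spectrumOf ν u) (hν : MemLp (spectrumOf ν) q lebUnit) :
    Tendsto (fun n => lpNorm (approxExcess ν k n) q lebUnit) atTop
      (𝓝 (lpNorm (fun u => spectrumOf ν u - k) q lebUnit)) := by
  have hq0 : q ≠ 0 := (zero_lt_one.trans hq).ne'
  have hpos := ENNReal.toReal_pos hq0 hq_top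
  have hm := memLp_sub_const hν k
  have h0 : 0 ≤ᵐ[lebUnit] fun u => spectrumOf ν u - k :=
    ae_lebUnit_of_forall fun u hu => sub_nonneg.2 (hk u ⟨hu.1.le, hu.2⟩)
  have h1 : Tendsto (fun n => ∫ u, approxExcess ν k n u ^ q.toReal ∂lebUnit) atTop
      (𝓝 (∫ u, (spectrumOf ν u - k) ^ q.toReal ∂lebUnit)) := by
    refine tendsto_integral_of_dominated_convergence _
      (fun n => ((isTest_approxExcess hk n).monotone.measurable.pow_const _).aestronglyMeasurable)
      (integrable_rpow_of_memLp hq0 hq_top h0 hm) (fun n => ae_lebUnit_of_forall fun u hu => ?_)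
      (ae_lebUnit_of_forall fun u hu => (tendsto_approxExcess hu).rpow_const (Or.inr hpos.le))
    have h1 := approxExcess_nonneg hk n u
    rw [Real.norm_of_nonneg (Real.rpow_nonneg h1 _)]
    exact Real.rpow_le_rpow h1 (approxExcess_le hk n hu) hpos.le
  have h2 := h1.rpow_const (p := q.toReal⁻¹) (Or.inr (inv_nonneg.2 hpos.le))
  rw [← lpNorm_rpow_eq_integral hq0 hq_top hm.1 h0, Real.rpow_rpow_inv lpNorm_nonneg hpos.ne'] at h2
  refine h2.congr fun n => ?_
  rw [← lpNorm_rpow_eq_integral hq0 hq_top ((isTest_approxExcess hk n).memLp (p := q)).1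
    (Eventually.of_forall (approxExcess_nonneg hk n)), Real.rpow_rpow_inv lpNorm_nonneg hpos.ne']

end ApproxExcess

/-! ### Closedness and minimality -/

section Minimal

variable {M : Set Prob}

lemma integral_mul_le_of_isKusuokaSet (hK : IsKusuokaSet (volume : Measure unitInterval) p
    (semideviation volume p lam) M) {ν : Prob} (hν : ν ∈ M) (g : ℝ → ℝ) (b : ℝ)
    (hg : IsTest g b) :
    ∫ u, spectrumOf ν u * g u ∂lebUnit ≤ semideviation lebUnit p lam g := by
  have h := (hK _ hg.memLp_coe).2.1 (mem_image_of_mem _ hν)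
  simp only [hg.integral_avar_coe] at h
  rwa [hg.semideviation_coe] at h

/-- The set is an intersection of weakly closed conditions, one for each test: membership implies
them by the Kusuoka property, and they imply membership by the norm bound. -/
lemma isClosed_semideviationSet (hp : 1 < p) (hp_top : p ≠ ∞)
    (hpq : ENNReal.HolderConjugate p q) (hl0 : 0 ≤ lam) (hl1 : lam ≤ 1) :
    IsClosed (semideviationSet q lam) := by
  have hK := isKusuokaSet_semideviationSet (P := (volume : Measure unitInterval)) hp.le hp_top hpq
    hl0 hl1
  have : semideviationSet q lam = {ν | ∀ g b, IsTest g b →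
      ∫ u, spectrumOf ν u * g u ∂lebUnit ≤ semideviation lebUnit p lam g} := by
    ext ν
    refine ⟨fun hν => integral_mul_le_of_isKusuokaSet hK hν, fun hν => ?_⟩
    obtain ⟨h1, h2⟩ := lpNorm_sub_le_of_forall_isTest hp hp_top hpq hl0 hν
    exact mem_semideviationSet_of_lpNorm_le hpq.symm.one_le hl0 hl1 h1 h2
  rw [this]
  simp only [ofPred_forall]
  exact isClosed_iInter fun g => isClosed_iInter fun b => isClosed_iInter fun hg =>
    isClosed_le hg.continuous_integral_mul continuous_const

lemma semideviationSet_subset (hp : 1 < p) (hp_top : p ≠ ∞)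
    (hpq : ENNReal.HolderConjugate p q) (hl0 : 0 ≤ lam) (hl1 : lam ≤ 1) (hM : IsClosed M)
    (hK : IsKusuokaSet (volume : Measure unitInterval) p (semideviation volume p lam) M) :
    semideviationSet q lam ⊆ M := by
  intro ν hν
  have hq := one_lt_conjugate hpq hp_top
  have hq_top := conjugate_ne_top hpq hp
  have hνq := memLp_spectrumOf_of_mem hq.le hl0 hl1 hν
  obtain ⟨k, hk, hnorm⟩ := exists_lpNorm_sub_const_of_mem hq.le hl0 hl1 hν
  have hbound : ∀ κ ∈ M, MemLp (spectrumOf κ) q lebUnit ∧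
      lpNorm (fun u => spectrumOf κ u - spectrumOf κ 0) q lebUnit ≤ lam := fun κ hκ =>
    lpNorm_sub_le_of_forall_isTest hp hp_top hpq hl0 (integral_mul_le_of_isKusuokaSet hK hκ)
  have hatt := fun {h : ℝ → ℝ} {b : ℝ} (hh : IsTest h b) =>
    exists_eq_semideviation hp.le hp_top hl0 hM hK hh
  rcases hl0.eq_or_lt with rfl | hl
  -- For `lam = 0` every spectrum involved is the constant `1`, so it suffices that `M` is nonempty,
  -- which attainment at any test provides.
  · have hone : ∀ (κ : Prob) (c : ℝ), MemLp (spectrumOf κ) q lebUnit →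
        lpNorm (fun u => spectrumOf κ u - c) q lebUnit ≤ 0 →
        spectrumOf κ =ᵐ[lebUnit] fun _ => 1 := fun κ c hκ hc =>
      ae_eq_one_of_ae_eq_const (k := c) (((lpNorm_eq_zero (memLp_sub_const hκ c)
        (zero_lt_one.trans hq).ne').1 (hc.antisymm lpNorm_nonneg)).mono
          fun u hu => sub_eq_zero.1 hu)
    obtain ⟨κ, hκ, -⟩ := hatt (isTest_indicator_Ici (a := 0) ⟨le_rfl, zero_lt_one⟩)
    have h1 := hone κ _ (hbound κ hκ).1 (hbound κ hκ).2
    have h2 := hone ν k hνq hnorm.le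
    rwa [eq_of_spectrumOf_ae_eq (h2.trans h1.symm)]
  · set F : ℕ → ℝ := fun n => lpNorm (approxExcess ν k n) q lebUnit
    have hF : Tendsto F atTop (𝓝 lam) := hnorm ▸ tendsto_lpNorm_approxExcess hq hq_top hk hνq
    have hex : ∀ n, ∃ κ ∈ M, 0 < F n → spectrumOf κ =ᵐ[lebUnit]
        fun u => spectrumOf κ 0 + lam / F n * approxExcess ν k n u := fun n => by
      have hf := isTest_approxExcess hk n
      obtain ⟨κ, hκ, heq⟩ := hatt (isTest_dualTest hq hq_top hf (level_pos n) (level_le n)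
        (approxExcess_of_lt n))
      exact ⟨κ, hκ, fun hFn => spectrumOf_ae_eq_of_attained hp hp_top hpq hl (hbound κ hκ).1
        (hbound κ hκ).2 hf (level_pos n) (level_le n) (approxExcess_of_lt n) hFn heq⟩
    choose κ hκM hκ using hex
    have hFpos : ∀ᶠ n in atTop, 0 < F n := hF.eventually (eventually_gt_nhds hl)
    have hratio : Tendsto (fun n => lam / F n) atTop (𝓝 1) := by
      have := (tendsto_const_nhds (x := lam)).div hF hl.ne'
      rwa [div_self hl.ne'] at this
    have hint : ∀ {g : ℝ → ℝ} {b : ℝ}, IsTest g b → ∀ᶠ n in atTop,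
        spectrumOf (κ n) 0 * ∫ u, g u ∂lebUnit +
          lam / F n * ∫ u, approxExcess ν k n u * g u ∂lebUnit =
          ∫ u, spectrumOf (κ n) u * g u ∂lebUnit := fun {g b} hg => by
      filter_upwards [hFpos] with n hn
      have hgi := (hg.memLp (p := 1)).integrable le_rfl
      have hfg : Integrable (fun u => approxExcess ν k n u * g u) lebUnit :=
        haveI : ENNReal.HolderTriple 1 ∞ 1 := ENNReal.HolderConjugate.one_top
        ((isTest_approxExcess hk n).memLp (p := 1)).integrable_mul (hg.memLp (p := ∞))
      rw [← integral_const_mul, ← integral_const_mul, ← integral_add (hgi.const_mul _)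
        (hfg.const_mul _)]
      refine integral_congr_ae ((hκ n hn).mono fun u hu => ?_)
      simp only
      rw [hu]
      ring
    have htest1 : IsTest (fun _ => 1) 0 :=
      ⟨monotone_const, fun _ => continuousWithinAt_const, ⟨le_rfl, zero_lt_one⟩, fun _ _ => rfl⟩
    -- Test with `g = 1`: since `∫ 𝕋κₙ = 1` and the integrals of the approximants tend to `1 - k`,
    -- the free constant `𝕋κₙ(0)` must tend to `k`.
    have hk0 : Tendsto (fun n => spectrumOf (κ n) 0) atTop (𝓝 k) := by
      have h1 := hratio.mul (tendsto_integral_approxExcess_mul hk htest1)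
      have h2 := (tendsto_const_nhds (x := (1 : ℝ))).sub h1
      simp only [mul_one, integral_spectrumOf, integral_const, probReal_univ, one_smul,
        one_mul, sub_sub_cancel] at h2
      refine h2.congr' ((hint htest1).mono fun n hn => ?_)
      simp only [mul_one, integral_spectrumOf, integral_const, probReal_univ, one_smul] at hn
      linarith
    have hlim : ∀ {g : ℝ → ℝ} {b : ℝ}, IsTest g b →
        Tendsto (fun n => ∫ u, spectrumOf (κ n) u * g u ∂lebUnit) atTop
          (𝓝 (∫ u, spectrumOf ν u * g u ∂lebUnit)) := fun {g b} hg => by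
      have h1 := (hk0.mul_const (∫ u, g u ∂lebUnit)).add
        (hratio.mul (tendsto_integral_approxExcess_mul hk hg))
      rw [one_mul, add_sub_cancel] at h1
      exact h1.congr' (hint hg)
    obtain ⟨ν', hν', hcl⟩ := (isCompact_of_isKusuokaSet hp.le hp_top hl0 hM hK).exists_mapClusterPt
      (f := atTop) (u := κ) (tendsto_principal.2 (Eventually.of_forall hκM))
    -- Along an ultrafilter `κₙ` converges to a point of `M` whose integrals against all tests are
    -- those of `ν`; tests separate measures.
    obtain ⟨U, hU, hUt⟩ := mapClusterPt_iff_ultrafilter.1 hcl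
    have : ν' = ν := eq_of_forall_isTest fun g b hg => tendsto_nhds_unique
      ((hg.continuous_integral_mul.tendsto ν').comp hUt) ((hlim hg).mono_left hU)
    rwa [← this]

theorem isMinimalKusuokaSet_semideviationSet (hp : 1 < p) (hp_top : p ≠ ∞)
    (hpq : ENNReal.HolderConjugate p q) (hl0 : 0 ≤ lam) (hl1 : lam ≤ 1) :
    IsMinimalKusuokaSet (volume : Measure unitInterval) p (semideviation volume p lam)
      (semideviationSet q lam) where
  isKusuokaSet := isKusuokaSet_semideviationSet hp.le hp_top hpq hl0 hl1
  isClosed := isClosed_semideviationSet hp hp_top hpq hl0 hl1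
  subset _ hM hK := semideviationSet_subset hp hp_top hpq hl0 hl1 hM hK

end Minimal

end Kusuoka

theorem mainTheorem10 (p q : ℝ≥0∞) (hp : 1 ≤ p) (hp_top : p ≠ ⊤)
    (hpq : ENNReal.HolderConjugate p q) (lam : ℝ) (hl0 : 0 ≤ lam) (hl1 : lam ≤ 1) :
    (∀ Z : unitInterval → ℝ, MemLp Z p volume →
      (∀ σ : ℝ → ℝ, Kusuoka.IsSpectral σ → MemLp σ q Kusuoka.lebUnit →
        Integrable (fun u => σ u * Kusuoka.quantile volume Z u) Kusuoka.lebUnit) ∧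
      IsLUB {x : ℝ | ∃ σ : ℝ → ℝ, Kusuoka.IsSpectral σ ∧ MemLp σ q Kusuoka.lebUnit ∧
          x = (1 - lam / Kusuoka.specNorm q σ) * (∫ ω, Z ω) +
            lam / Kusuoka.specNorm q σ * Kusuoka.spectralRisk volume σ Z}
        (Kusuoka.semideviation volume p lam Z)) ∧
    Kusuoka.IsKusuokaSet (volume : Measure unitInterval) p (Kusuoka.semideviation volume p lam)
      (Kusuoka.semideviationSet q lam) ∧
    (1 < p → Kusuoka.IsMinimalKusuokaSet (volume : Measure unitInterval) p
      (Kusuoka.semideviation volume p lam) (Kusuoka.semideviationSet q lam)) :=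
  ⟨fun _ hZ => ⟨fun _ _ hσ => Kusuoka.integrable_mul_quantile hpq hσ hZ,
    Kusuoka.isLUB_semideviation hp hp_top hpq hl0 hZ⟩,
    Kusuoka.isKusuokaSet_semideviationSet hp hp_top hpq hl0 hl1,
    fun hp1 => Kusuoka.isMinimalKusuokaSet_semideviationSet hp1 hp_top hpq hl0 hl1⟩
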